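/- Let $L>0$, let $q\in L_2[0,L]$ be complex valued and let $h\in\mathbb{C}$. For $\rho\in\mathbb{C}$ let $S(\rho,\cdot)$ and $\phi(\rho,\cdot)$ be the solutions on $[0,L]$ of $$-y''+q(x)y=\rho^2y,\qquad 0<x<L,$$ with $S(\rho,0)=0$, $S'(\rho,0)=1$ and $\phi(\rho,0)=1$, $\phi'(\rho,0)=h$, where a solution is a differentiable function $y$ whose derivative $y'$ is absolutely continuous on $[0,L]$ and which satisfies the equation almost everywhere. Let $\operatorname{sinc}(z)=\frac{\sin(\pi z)}{\pi z}$ for $z\ne0$, $\operatorname{sinc}(0)=1$, and let $j_1(z)=\frac{\sin z}{z^2}-\frac{\cos z}{z}$ for $z\ne 0$, $j_1(0)=0$, be the spherical Bessel function of order one. Fix $x\in(0,L]$. Then the following holds. 1. For all $\rho\in\mathbb{C}$, $$S(\rho,x)=\frac{\sin(\rho x)}{\rho}+\frac{1}{2\rho\sin(\rho x)}\sum_{n=0}^{\infty}s_n(x)\left(\operatorname{sinc}\left(\frac{2\rho x}{\pi}-2n-1\right)+\operatorname{sinc}\left(\frac{2\rho x}{\pi}+2n+1\right)\right),$$ where $$s_n(x)=\frac{(-1)^n(2n+1)\pi}{x}\,S\left(\frac{2n+1}{2x}\pi,x\right)-2,\qquad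 n=0,1,\ldots;$$ the series converges for every $\rho\in\mathbb{C}$, and at the points where $\sin(\rho x)=0$, which are removable singularities, the right-hand side is understood as its limit. 2. For all $\rho\in\mathbb{C}$, $$\phi(\rho,x)=-\rho x\,j_1(\rho x)+\sum_{n=0}^{\infty}\phi_n(x)\left(\operatorname{sinc}\left(\frac{\rho x}{\pi}-n\right)+\operatorname{sinc}\left(\frac{\rho x}{\pi}+n\right)\right),$$ where $$\phi_0(x)=\frac{\phi(0,x)}{2},\qquad \phi_n(x)=\phi\left(\frac{n\pi}{x},x\right)-(-1)^n,\quad n=1,2,\ldots.$$ 3. As series of functions of $\rho$, both series converge absolutely for every $\rho\in\mathbb{C}$ and uniformly on every compact subset of $\mathbb{C}$. On the real line they converge in the norm of $L_2(\mathbb{R})$ and absolutely and uniformly (the series of absolute values converges uniformly on $\mathbb{R}$ as well). For $S$ all convergence statements on compact subsets of $\mathbb{C}$ and on $\mathbb{R}$ hold both for the series $\sum_n s_n(x)(\cdots)$ itself and for the series whose terms are multiplied by $\frac{1}{2\rho\sin(\rho x)}$, the latter on the set of those $\rho$ with $\sin(\rho x)\neq0$. -/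

import Mathlib

open Filter Topology MeasureTheory

/-- `y` is the (Carathéodory) solution on `[0, L]` of the Sturm–Liouville equation
`-y'' + q y = ρ² y` with the initial values `y(0) = a`, `y'(0) = b`: `y` is differentiable on
`[0, L]`, its derivative `y'` is absolutely continuous on `[0, L]`, and the equation holds almost
everywhere on `(0, L)`. -/
def SolvesSturmLiouville (q : ℝ → ℂ) (L : ℝ) (ρ a b : ℂ) (y : ℝ → ℂ) : Prop :=
  ∃ y' : ℝ → ℂ,
    y 0 = a ∧ y' 0 = b ∧
    (∀ t ∈ Set.Icc 0 L, HasDerivWithinAt y (y' t) (Set.Icc 0 L) t) ∧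
    AbsolutelyContinuousOnInterval y' 0 L ∧
    ∀ᵐ t : ℝ, t ∈ Set.Ioo 0 L →
      ∃ y'' : ℂ, HasDerivAt y' y'' t ∧ -y'' + q t * y t = ρ ^ 2 * y t

/-- The normalized sinc function on `ℂ`. -/
noncomputable def normSinc (z : ℂ) : ℂ :=
  if z = 0 then 1 else Complex.sin (Real.pi * z) / (Real.pi * z)

/-- The spherical Bessel function of the first kind of order one (an entire function with
value `0` at `0`). -/
noncomputable def sphericalBesselJOne (z : ℂ) : ℂ :=
  if z = 0 then 0 else Complex.sin z / z ^ 2 - Complex.cos z / z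

/-- `sinc(2ρx/π - 2n - 1) + sinc(2ρx/π + 2n + 1)`. -/
noncomputable def oddSincPair (x : ℝ) (n : ℕ) (ρ : ℂ) : ℂ :=
  normSinc (2 * ρ * x / Real.pi - 2 * n - 1) + normSinc (2 * ρ * x / Real.pi + 2 * n + 1)

/-- `sinc(ρx/π - n) + sinc(ρx/π + n)`. -/
noncomputable def sincPair (x : ℝ) (n : ℕ) (ρ : ℂ) : ℂ :=
  normSinc (ρ * x / Real.pi - n) + normSinc (ρ * x / Real.pi + n)

/-- The coefficient `s_n(x) = ((-1)^n (2n+1) π / x) S((2n+1)π/(2x), x) - 2`. -/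
noncomputable def sCoeff (S : ℂ → ℝ → ℂ) (x : ℝ) (n : ℕ) : ℂ :=
  (-1) ^ n * (2 * n + 1) * Real.pi / x * S ((2 * n + 1) / (2 * x) * Real.pi) x - 2

/-- The coefficients `φ_0(x) = φ(0, x) / 2` and `φ_n(x) = φ(nπ/x, x) - (-1)^n` for `n ≥ 1`. -/
noncomputable def phiCoeff (φ : ℂ → ℝ → ℂ) (x : ℝ) (n : ℕ) : ℂ :=
  if n = 0 then φ 0 x / 2 else φ (n * Real.pi / x) x - (-1) ^ n

/-- The series of functions `∑ u_n` converges to `f` on `D ⊆ ℂ` in the following senses: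
uniformly on (the part in `D` of) each compact subset of `ℂ`; uniformly on the real points of `D`;
absolutely at the real points of `D`, with the series of absolute values also converging uniformly
there; and in the norm of `L₂(ℝ)`. (The last clause is used when almost every real number is
in `D`.) -/
structure SeriesConverges (D : Set ℂ) (u : ℕ → ℂ → ℂ) (f : ℂ → ℂ) : Prop where
  uniform_on_compacts : ∀ K : Set ℂ, IsCompact K →
    TendstoUniformlyOn (fun (N : ℕ) (ρ : ℂ) => ∑ n ∈ Finset.range N, u n ρ) f atTop (K ∩ D)
  uniform_on_reals :
    TendstoUniformlyOn (fun (N : ℕ) (ρ : ℝ) => ∑ n ∈ Finset.range N, u n (ρ : ℂ))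
      (fun ρ : ℝ => f (ρ : ℂ)) atTop {ρ : ℝ | (ρ : ℂ) ∈ D}
  absolute_on_reals : ∀ ρ : ℝ, (ρ : ℂ) ∈ D → Summable fun n => ‖u n (ρ : ℂ)‖
  absolute_uniform_on_reals :
    TendstoUniformlyOn (fun (N : ℕ) (ρ : ℝ) => ∑ n ∈ Finset.range N, ‖u n (ρ : ℂ)‖)
      (fun ρ : ℝ => ∑' n, ‖u n (ρ : ℂ)‖) atTop {ρ : ℝ | (ρ : ℂ) ∈ D}
  memLp_term : ∀ n, MemLp (fun ρ : ℝ => u n (ρ : ℂ)) 2 volume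
  memLp_sum : MemLp (fun ρ : ℝ => f (ρ : ℂ)) 2 volume
  tendsto_L2 : Tendsto
    (fun N : ℕ =>
      eLpNorm (fun ρ : ℝ => f (ρ : ℂ) - ∑ n ∈ Finset.range N, u n (ρ : ℂ)) 2 volume)
    atTop (𝓝 0)

/-! Both expansions are cardinal series. Fix `x`. By the Volterra equation, `S(ρ,x) - sin(ρx)/ρ` is
an even entire function of `ρ`, bounded by a multiple of `exp(|Im ρ| x)` and tending to zero along
the real axis. The same holds for `φ(ρ,x) - (cos ρx - sin(ρx)/(ρx))`, and the bracket is exactly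
`-ρx j₁(ρx)`. A function of this kind is determined by its values at equally spaced real nodes of
step `π/x`: dividing the difference of two candidates by the matching sine gives a bounded entire
function, so the difference is a multiple of the sine, and decay on the real axis makes the multiple
zero (`eq_zero_of_exponential_type`, `eq_tsum_pair`). It remains to build a sinc series with the
right values at the nodes.

For `φ` the nodes are `kπ/x`. For `S` they are `(k + 1/2)π/x`: the pairs in the statement have type
`2x`, but each one equals `2ρ sin(ρx)` times a pair of type `x` centred at half-integers
(`oddSincPair_eq`), so the prefactor turns the series into an ordinary cardinal series.

All convergence statements follow from absolute summability of the coefficients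
(`seriesConverges_of_pair`). One iteration of the Volterra equation expresses a coefficient at a
node `r` as a sine Fourier coefficient of `q`, up to a bounded factor, divided by `r`, plus
`O(1/r²)`. The Fourier coefficients are square summable and `r` grows linearly, so the coefficients
are summable.

Analyticity in `ρ` is proved in `differentiable_solution` from the Lagrange identity, and evenness
comes from uniqueness for the initial value problem. -/

namespace SturmLiouville

open Set

/-! ### Carathéodory solutions and the Lagrange identity -/

/-- Composition of an absolutely continuous function with a `1`-Lipschitz map. -/
lemma _root_.AbsolutelyContinuousOnInterval.comp_of_dist_le {f : ℝ → ℂ} {a b : ℝ} {g : ℂ → ℝ}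
    (hf : AbsolutelyContinuousOnInterval f a b) (hg : ∀ z w, dist (g z) (g w) ≤ dist z w) :
    AbsolutelyContinuousOnInterval (fun t => g (f t)) a b := by
  rw [absolutelyContinuousOnInterval_iff] at hf ⊢
  intro ε hε
  obtain ⟨δ, hδ, h⟩ := hf ε hε
  exact ⟨δ, hδ, fun E h1 h2 => (Finset.sum_le_sum fun i _ => hg _ _).trans_lt (h E h1 h2)⟩

/-- Real and imaginary parts inherit absolute continuity, which reduces the complex fundamental
theorem of calculus to the real one. -/
lemma _root_.AbsolutelyContinuousOnInterval.integrable_and_integral_eq_sub {f f' : ℝ → ℂ}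
    {T : ℝ} (hT : 0 ≤ T) (hf : AbsolutelyContinuousOnInterval f 0 T)
    (hd : ∀ᵐ t : ℝ, t ∈ Ioo 0 T → HasDerivAt f (f' t) t) :
    IntervalIntegrable f' volume 0 T ∧ ∫ t in 0..T, f' t = f T - f 0 := by
  have hre := hf.comp_of_dist_le (g := Complex.re) fun z w => by
    simpa [Complex.dist_eq, Real.dist_eq] using Complex.abs_re_le_norm (z - w)
  have him := hf.comp_of_dist_le (g := Complex.im) fun z w => by
    simpa [Complex.dist_eq, Real.dist_eq] using Complex.abs_im_le_norm (z - w)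
  have hne : ∀ᵐ t : ℝ, t ≠ T := by simp [ae_iff]
  have key : ∀ᵐ t : ℝ, t ∈ uIoc 0 T →
      ((deriv (fun t => (f t).re) t : ℝ) : ℂ) + (deriv (fun t => (f t).im) t : ℝ) * Complex.I
        = f' t := by
    filter_upwards [hd, hne] with t ht hne hm
    rw [uIoc_of_le hT] at hm
    have h := ht ⟨hm.1, lt_of_le_of_ne hm.2 hne⟩
    have h1 : HasDerivAt (fun t => (f t).re) (f' t).re t :=
      Complex.reCLM.hasFDerivAt.comp_hasDerivAt t h
    have h2 : HasDerivAt (fun t => (f t).im) (f' t).im t :=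
      Complex.imCLM.hasFDerivAt.comp_hasDerivAt t h
    rw [h1.deriv, h2.deriv, Complex.re_add_im]
  have i1 : IntervalIntegrable (fun t => ((deriv (fun t => (f t).re) t : ℝ) : ℂ)) volume 0 T :=
    ⟨hre.intervalIntegrable_deriv.1.ofReal, hre.intervalIntegrable_deriv.2.ofReal⟩
  have i2 : IntervalIntegrable
      (fun t => (deriv (fun t => (f t).im) t : ℝ) * Complex.I) volume 0 T :=
    IntervalIntegrable.mul_const
      ⟨him.intervalIntegrable_deriv.1.ofReal, him.intervalIntegrable_deriv.2.ofReal⟩ _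
  refine ⟨(i1.add i2).congr_ae ((ae_restrict_iff' measurableSet_uIoc).2 key), ?_⟩
  rw [← intervalIntegral.integral_congr_ae key, intervalIntegral.integral_add i1 i2,
    intervalIntegral.integral_mul_const, intervalIntegral.integral_ofReal,
    intervalIntegral.integral_ofReal, hre.integral_deriv_eq_sub, him.integral_deriv_eq_sub]
  apply Complex.ext <;> simp

/-- `y` is a Carathéodory solution of `y'' = p y` on `[0, T]` with derivative `y'`. -/
structure IsSol (p : ℝ → ℂ) (T : ℝ) (y y' : ℝ → ℂ) : Prop where
  hasDeriv : ∀ t ∈ Icc 0 T, HasDerivWithinAt y (y' t) (Icc 0 T) t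
  ac : AbsolutelyContinuousOnInterval y' 0 T
  eqn : ∀ᵐ t : ℝ, t ∈ Ioo 0 T → HasDerivAt y' (p t * y t) t

lemma _root_.SolvesSturmLiouville.exists_isSol {q : ℝ → ℂ} {L : ℝ} {ρ a b : ℂ} {y : ℝ → ℂ}
    (h : SolvesSturmLiouville q L ρ a b y) :
    ∃ y', y 0 = a ∧ y' 0 = b ∧ IsSol (fun t => q t - ρ ^ 2) L y y' := by
  obtain ⟨y', h0, h1, h2, h3, h4⟩ := h
  refine ⟨y', h0, h1, h2, h3, ?_⟩
  filter_upwards [h4] with t ht hm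
  obtain ⟨y'', h5, h6⟩ := ht hm
  convert h5 using 1
  linear_combination h6

namespace IsSol

variable {p r : ℝ → ℂ} {T : ℝ} {y y' z z' : ℝ → ℂ}

lemma mono (h : IsSol p T y y') {t : ℝ} (ht : t ∈ Icc 0 T) : IsSol p t y y' := by
  have hs : Icc 0 t ⊆ Icc 0 T := Icc_subset_Icc_right ht.2
  refine ⟨fun s hs' => (h.hasDeriv s (hs hs')).mono hs, h.ac.mono ?_, ?_⟩
  · rwa [uIcc_of_le ht.1, uIcc_of_le (ht.1.trans ht.2)]
  · filter_upwards [h.eqn] with s hs hm using hs ⟨hm.1, hm.2.trans_le ht.2⟩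

lemma continuousOn (h : IsSol p T y y') : ContinuousOn y (Icc 0 T) :=
  fun t ht => (h.hasDeriv t ht).continuousWithinAt

/-- An absolutely continuous `y'` is bounded, so `y` is Lipschitz. -/
lemma absolutelyContinuous (hT : 0 ≤ T) (h : IsSol p T y y') :
    AbsolutelyContinuousOnInterval y 0 T := by
  obtain ⟨C, hC⟩ := h.ac.exists_bound
  rw [uIcc_of_le hT] at hC
  have : LipschitzOnWith C.toNNReal y (Icc 0 T) :=
    (convex_Icc 0 T).lipschitzOnWith_of_nnnorm_hasDerivWithin_le h.hasDeriv fun t ht => by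
      rw [← NNReal.coe_le_coe, coe_nnnorm]
      exact (hC t ht).trans (Real.le_coe_toNNReal C)
  exact LipschitzOnWith.absolutelyContinuousOnInterval (K := C.toNNReal) (by rwa [uIcc_of_le hT])

/-- The Lagrange identity. -/
lemma lagrange (hT : 0 ≤ T) (hy : IsSol p T y y') (hz : IsSol r T z z') :
    IntervalIntegrable (fun t => (p t - r t) * (z t * y t)) volume 0 T ∧
    ∫ t in 0..T, (p t - r t) * (z t * y t) =
      (z T * y' T - z' T * y T) - (z 0 * y' 0 - z' 0 * y 0) := by
  refine AbsolutelyContinuousOnInterval.integrable_and_integral_eq_sub hT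
    (f := fun t => z t * y' t - z' t * y t) (((hz.absolutelyContinuous hT).fun_smul hy.ac).sub
      (hz.ac.fun_smul (hy.absolutelyContinuous hT))) ?_
  filter_upwards [hy.eqn, hz.eqn] with t h1 h2 hm
  have hn := Icc_mem_nhds hm.1 hm.2
  have hmI := Ioo_subset_Icc_self hm
  have h3 := (hy.hasDeriv t hmI).hasDerivAt hn
  have h4 := (hz.hasDeriv t hmI).hasDerivAt hn
  refine ((h4.mul (h1 hm)).sub ((h2 hm).mul h3)).congr_deriv ?_
  ring

end IsSol

/-! ### Bounds for sine and sinc in the complex plane -/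

lemma norm_exp_mul_I_le (z : ℂ) : ‖Complex.exp (z * Complex.I)‖ ≤ Real.exp |z.im| := by
  rw [Complex.norm_exp]
  simpa using neg_le_abs z.im

lemma norm_cos_le (z : ℂ) : ‖Complex.cos z‖ ≤ Real.exp |z.im| := by
  have h1 := norm_exp_mul_I_le z
  have h2 := norm_exp_mul_I_le (-z)
  simp only [Complex.neg_im, abs_neg] at h2
  rw [Complex.cos, norm_div, Complex.norm_two]
  linarith [norm_add_le (Complex.exp (z * Complex.I)) (Complex.exp (-z * Complex.I))]

lemma norm_sin_le (z : ℂ) : ‖Complex.sin z‖ ≤ Real.exp |z.im| := by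
  have h1 := norm_exp_mul_I_le z
  have h2 := norm_exp_mul_I_le (-z)
  simp only [Complex.neg_im, abs_neg] at h2
  rw [Complex.sin, norm_div, Complex.norm_two, norm_mul, Complex.norm_I, mul_one]
  linarith [norm_sub_le (Complex.exp (-z * Complex.I)) (Complex.exp (z * Complex.I))]

/-- Mean value inequality on the convex strip `|Im w| ≤ |Im z|`, where the derivative `cos` is at
most `exp |Im z|`. -/
lemma norm_sin_le_norm_mul (z : ℂ) : ‖Complex.sin z‖ ≤ ‖z‖ * Real.exp |z.im| := by
  have hc : Convex ℝ {w : ℂ | |w.im| ≤ |z.im|} := by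
    have : {w : ℂ | |w.im| ≤ |z.im|} = Complex.imLm ⁻¹' (Icc (-|z.im|) |z.im|) := by
      ext w; simp [abs_le]
    rw [this]
    exact (convex_Icc _ _).is_linear_preimage Complex.imLm.isLinear
  have h := hc.norm_image_sub_le_of_norm_hasDerivWithin_le (f := Complex.sin) (f' := Complex.cos)
    (C := Real.exp |z.im|) (x := 0) (y := z)
    (fun w _ => (Complex.hasDerivAt_sin w).hasDerivWithinAt)
    (fun w hw => (norm_cos_le w).trans (Real.exp_le_exp.2 hw))
    (show |(0 : ℂ).im| ≤ |z.im| by simp) (show |z.im| ≤ |z.im| from le_rfl)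
  simpa [mul_comm] using h

lemma mul_normSinc (z : ℂ) : Real.pi * z * normSinc z = Complex.sin (Real.pi * z) := by
  unfold normSinc
  split_ifs with h
  · simp [h]
  · field_simp

lemma normSinc_neg (z : ℂ) : normSinc (-z) = normSinc z := by
  simp [normSinc]

lemma abs_im_pi_mul (z : ℂ) : |((Real.pi : ℂ) * z).im| = Real.pi * |z.im| := by
  rw [Complex.im_ofReal_mul, abs_mul, abs_of_pos Real.pi_pos]

lemma norm_normSinc_le (z : ℂ) : ‖normSinc z‖ ≤ Real.exp (Real.pi * |z.im|) := by
  by_cases h : z = 0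
  · simp [h, normSinc]
  have h1 := norm_sin_le_norm_mul (Real.pi * z)
  have h2 : 0 < ‖(Real.pi : ℂ) * z‖ := norm_pos_iff.2 (mul_ne_zero (by simp) h)
  rw [← mul_normSinc, norm_mul, abs_im_pi_mul] at h1
  exact le_of_mul_le_mul_left h1 h2

lemma norm_normSinc_mul_le (z : ℂ) : ‖z‖ * ‖normSinc z‖ ≤ Real.exp (Real.pi * |z.im|) := by
  have h1 := norm_sin_le (Real.pi * z)
  rw [← mul_normSinc, norm_mul, norm_mul, abs_im_pi_mul, Complex.norm_real, Real.norm_of_nonneg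
    Real.pi_pos.le] at h1
  have h2 : 0 ≤ ‖z‖ * ‖normSinc z‖ := by positivity
  nlinarith [Real.pi_gt_three]

/-- Up to the scaling by `π`, sinc is the difference quotient of `sin` at `0`, whose singularity is
removable. -/
lemma differentiable_normSinc : Differentiable ℂ normSinc := by
  have h : Differentiable ℂ (dslope Complex.sin 0) := fun z =>
    ((Complex.differentiableOn_dslope univ_mem).2
      Complex.differentiable_sin.differentiableOn z (mem_univ z)).differentiableAt univ_mem
  have : normSinc = fun z => dslope Complex.sin 0 (Real.pi * z) := by
    funext z
    by_cases hz : z = 0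
    · simp [hz, normSinc, dslope_same]
    · rw [dslope_of_ne _ (mul_ne_zero (by simp) hz), slope_def_field]
      simp [normSinc, hz]
  rw [this]
  fun_prop

lemma normSinc_intCast (k : ℤ) (hk : k ≠ 0) : normSinc k = 0 := by
  have : (k : ℂ) ≠ 0 := by exact_mod_cast hk
  rw [normSinc, if_neg this, mul_comm, Complex.sin_int_mul_pi, zero_div]

lemma normSinc_zero : normSinc 0 = 1 := by simp [normSinc]

/-- The symmetric pair `sinc(a ρ - μ) + sinc(a ρ + μ)`. -/
noncomputable def pair (a μ : ℝ) (ρ : ℂ) : ℂ := normSinc (a * ρ - μ) + normSinc (a * ρ + μ)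

lemma differentiable_pair (a μ : ℝ) : Differentiable ℂ (pair a μ) := by
  have := differentiable_normSinc
  unfold pair
  fun_prop

lemma norm_pair_le (a μ : ℝ) (ρ : ℂ) : ‖pair a μ ρ‖ ≤ 2 * Real.exp (Real.pi * |a * ρ.im|) := by
  have h1 := norm_normSinc_le (a * ρ - μ)
  have h2 := norm_normSinc_le (a * ρ + μ)
  have h3 := norm_add_le (normSinc (a * ρ - μ)) (normSinc (a * ρ + μ))
  rw [show (a * ρ - μ : ℂ).im = a * ρ.im by simp] at h1
  rw [show (a * ρ + μ : ℂ).im = a * ρ.im by simp] at h2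
  rw [pair]
  linarith

lemma norm_pair_ofReal_le (a μ ρ : ℝ) : ‖pair a μ ρ‖ ≤ 2 := by
  simpa using norm_pair_le a μ ρ

lemma norm_sq_normSinc_ofReal_le (x : ℝ) : ‖normSinc x‖ ^ 2 ≤ 2 * (1 + x ^ 2)⁻¹ := by
  have h1 := norm_normSinc_le x
  have h2 := norm_normSinc_mul_le x
  simp only [Complex.ofReal_im, abs_zero, mul_zero, Real.exp_zero, Complex.norm_real,
    Real.norm_eq_abs] at h1 h2
  have h0 := norm_nonneg (normSinc x)
  rw [← div_eq_mul_inv, le_div_iff₀ (by positivity)]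
  have h3 : (|x| * ‖normSinc x‖) ^ 2 ≤ 1 := pow_le_one₀ (by positivity) h2
  rw [mul_pow, sq_abs] at h3
  nlinarith

lemma tendsto_normSinc_ofReal (a μ : ℝ) (ha : 0 < a) :
    Tendsto (fun x : ℝ => normSinc (a * x + μ)) atTop (𝓝 0) := by
  have h1 : Tendsto (fun x : ℝ => (|a * x + μ|)⁻¹) atTop (𝓝 0) :=
    tendsto_inv_atTop_zero.comp (tendsto_abs_atTop_atTop.comp
      (tendsto_atTop_add_const_right _ _ (tendsto_id.const_mul_atTop ha)))
  refine squeeze_zero_norm' ?_ h1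
  have h2 : ∀ᶠ x : ℝ in atTop, 0 < a * x + μ :=
    (tendsto_atTop_add_const_right _ _ (tendsto_id.const_mul_atTop ha)).eventually_gt_atTop 0
  filter_upwards [h2] with x hx
  have h3 := norm_normSinc_mul_le ((a * x + μ : ℝ) : ℂ)
  simp only [Complex.ofReal_im, abs_zero, mul_zero, Real.exp_zero, Complex.norm_real,
    Real.norm_eq_abs] at h3
  push_cast at h3
  exact (le_inv_mul_iff₀ (abs_pos.2 hx.ne')).2 h3 |>.trans (by rw [mul_one])

lemma tendsto_pair_ofReal (a μ : ℝ) (ha : 0 < a) :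
    Tendsto (fun x : ℝ => pair a μ x) atTop (𝓝 0) := by
  have h1 := tendsto_normSinc_ofReal a (-μ) ha
  have h2 := tendsto_normSinc_ofReal a μ ha
  simpa [pair, sub_eq_add_neg] using h1.add h2

lemma continuous_normSinc : Continuous normSinc := differentiable_normSinc.continuous

lemma memLp_normSinc (a : ℝ) (ha : a ≠ 0) :
    MemLp (fun x : ℝ => normSinc (a * x)) 2 volume := by
  have hc := continuous_normSinc
  have hm : AEStronglyMeasurable (fun x : ℝ => normSinc (a * x)) volume := by
    apply Continuous.aestronglyMeasurable
    fun_prop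
  rw [memLp_two_iff_integrable_sq_norm hm]
  have h : Integrable (fun x : ℝ => 2 * (1 + (a * x) ^ 2)⁻¹) :=
    (integrable_inv_one_add_sq.comp_mul_left' ha).const_mul 2
  refine h.mono (by fun_prop) (Eventually.of_forall fun x => ?_)
  have h1 := norm_sq_normSinc_ofReal_le (a * x)
  rw [Real.norm_of_nonneg (by positivity), Real.norm_of_nonneg (by positivity)]
  simpa using h1

/-- A shift of the centre is a translation of the line, so the `L₂` norm does not depend on `μ`;
this makes the `L₂` bounds uniform over the series. -/
lemma memLp_normSinc_add (a μ : ℝ) (ha : a ≠ 0) :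
    MemLp (fun x : ℝ => normSinc (a * x + μ)) 2 volume ∧
    eLpNorm (fun x : ℝ => normSinc (a * x + μ)) 2 volume =
      eLpNorm (fun x : ℝ => normSinc (a * x)) 2 volume := by
  have h := measurePreserving_add_right (volume : Measure ℝ) (μ / a)
  have e : (fun x : ℝ => normSinc (a * x + μ)) =
      (fun x : ℝ => normSinc (a * x)) ∘ fun x => x + μ / a := by
    funext x
    have : (a : ℂ) ≠ 0 := by exact_mod_cast ha
    simp only [Function.comp, Complex.ofReal_add, Complex.ofReal_div]
    congr 1
    field_simp
  rw [e]
  exact ⟨(memLp_normSinc a ha).comp_measurePreserving h,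
    eLpNorm_comp_measurePreserving (memLp_normSinc a ha).1 h⟩

lemma memLp_pair (a μ : ℝ) (ha : a ≠ 0) : MemLp (fun x : ℝ => pair a μ x) 2 volume := by
  have h1 := (memLp_normSinc_add a (-μ) ha).1
  have h2 := (memLp_normSinc_add a μ ha).1
  refine (h1.add h2).ae_eq (Eventually.of_forall fun x => ?_)
  simp [pair, sub_eq_add_neg]

lemma eLpNorm_pair_le (a μ : ℝ) (ha : a ≠ 0) :
    eLpNorm (fun x : ℝ => pair a μ x) 2 volume ≤
      2 * eLpNorm (fun x : ℝ => normSinc (a * x)) 2 volume := by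
  have h1 := memLp_normSinc_add a (-μ) ha
  have h2 := memLp_normSinc_add a μ ha
  have := eLpNorm_add_le h1.1.1 h2.1.1 (by norm_num : (1 : ENNReal) ≤ 2)
  rw [h1.2, h2.2, ← two_mul] at this
  refine le_trans (le_of_eq ?_) this
  congr 1
  funext x
  simp [pair, sub_eq_add_neg]

/-! ### Sinc series with absolutely summable coefficients -/

section Series

variable {a : ℝ} {μ : ℕ → ℝ} {c : ℕ → ℂ}

lemma norm_term_le (c : ℂ) (a μ : ℝ) {B : ℝ} {ρ : ℂ} (h : |ρ.im| ≤ B) :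
    ‖c * pair a μ ρ‖ ≤ ‖c‖ * (2 * Real.exp (Real.pi * (|a| * B))) := by
  rw [norm_mul]
  refine mul_le_mul_of_nonneg_left ((norm_pair_le a μ ρ).trans ?_) (norm_nonneg _)
  rw [abs_mul]
  gcongr

lemma summable_norm_term (hc : Summable fun n => ‖c n‖) (ρ : ℂ) :
    Summable fun n => ‖c n * pair a (μ n) ρ‖ :=
  .of_nonneg_of_le (fun _ => norm_nonneg _) (fun n => norm_term_le (c n) a (μ n) le_rfl)
    (hc.mul_right _)

lemma norm_tsum_term_le (hc : Summable fun n => ‖c n‖) (ρ : ℂ) :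
    ‖∑' n, c n * pair a (μ n) ρ‖ ≤
      (∑' n, ‖c n‖) * 2 * Real.exp (Real.pi * (|a| * |ρ.im|)) := by
  refine (norm_tsum_le_tsum_norm (summable_norm_term hc ρ)).trans ?_
  refine ((summable_norm_term hc ρ).tsum_le_tsum
    (fun n => norm_term_le (c n) a (μ n) le_rfl) (hc.mul_right _)).trans (le_of_eq ?_)
  rw [tsum_mul_right, mul_assoc]

lemma differentiable_tsum_term (hc : Summable fun n => ‖c n‖) :
    Differentiable ℂ fun ρ => ∑' n, c n * pair a (μ n) ρ := by
  intro z
  have hU : IsOpen (Metric.ball z 1) := Metric.isOpen_ball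
  refine (Complex.differentiableOn_tsum_of_summable_norm
    (u := fun n => ‖c n‖ * (2 * Real.exp (Real.pi * (|a| * (‖z‖ + 1)))))
    (hc.mul_right _) (fun n => ((differentiable_pair a (μ n)).const_mul _).differentiableOn) hU
    fun n w hw => norm_term_le _ _ _ ?_).differentiableAt
      (hU.mem_nhds (Metric.mem_ball_self one_pos))
  rw [Metric.mem_ball, dist_eq_norm] at hw
  have h1 := Complex.abs_im_le_norm w
  have h2 := norm_le_norm_add_norm_sub' w z
  linarith

lemma tendsto_tsum_term_ofReal (ha : 0 < a) (hc : Summable fun n => ‖c n‖) :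
    Tendsto (fun x : ℝ => ∑' n, c n * pair a (μ n) x) atTop (𝓝 0) := by
  have := tendsto_tsum_of_dominated_convergence (𝓕 := atTop)
    (f := fun (x : ℝ) n => c n * pair a (μ n) x) (g := fun _ => 0) (hc.mul_right 2)
    (fun n => by simpa using (tendsto_pair_ofReal a (μ n) ha).const_mul (c n))
    (Eventually.of_forall fun x n => by
      rw [norm_mul]
      exact mul_le_mul_of_nonneg_left (norm_pair_ofReal_le _ _ _) (norm_nonneg _))
  simpa using this

/-- A series `∑ cₙ (sinc(a ρ - μₙ) + sinc(a ρ + μₙ))` with absolutely summable coefficients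
converges in all the senses of `SeriesConverges`. -/
theorem seriesConverges_of_pair (ha : a ≠ 0) (hc : Summable fun n => ‖c n‖) {D : Set ℂ}
    {u : ℕ → ℂ → ℂ} {f : ℂ → ℂ} (hu : ∀ n, ∀ ρ ∈ D, u n ρ = c n * pair a (μ n) ρ)
    (hf : ∀ ρ ∈ D, f ρ = ∑' n, c n * pair a (μ n) ρ) (hD : ∀ᵐ ρ : ℝ, (ρ : ℂ) ∈ D) :
    SeriesConverges D u f := by
  have hsum : ∀ ρ ∈ D, f ρ = ∑' n, u n ρ := fun ρ hρ => by
    rw [hf ρ hρ]; exact tsum_congr fun n => (hu n ρ hρ).symm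
  have hub : ∀ n (ρ : ℝ), (ρ : ℂ) ∈ D → ‖u n ρ‖ ≤ ‖c n‖ * 2 := fun n ρ hρ => by
    rw [hu n ρ hρ, norm_mul]
    exact mul_le_mul_of_nonneg_left (norm_pair_ofReal_le _ _ _) (norm_nonneg _)
  have huae : ∀ n, (fun ρ : ℝ => u n ρ) =ᵐ[volume] fun ρ : ℝ => c n * pair a (μ n) ρ := fun n => by
    filter_upwards [hD] with ρ hρ using hu n ρ hρ
  have hmem : ∀ n, MemLp (fun ρ : ℝ => u n ρ) 2 volume := fun n =>
    (memLp_congr_ae (huae n)).2 ((memLp_pair a (μ n) ha).const_mul (c n))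
  -- A bound for the `L₂` norm of every pair, independent of `n`.
  set K := 2 * eLpNorm (fun x : ℝ => normSinc (a * x)) 2 volume with hK
  have hKtop : K ≠ ⊤ := ENNReal.mul_ne_top (by simp) (memLp_normSinc a ha).eLpNorm_ne_top
  have hnorm : ∀ n, eLpNorm (fun ρ : ℝ => u n ρ) 2 volume ≤ ‖c n‖ₑ * K := fun n => by
    rw [eLpNorm_congr_ae (huae n)]
    have := eLpNorm_const_smul (c n) (fun ρ : ℝ => pair a (μ n) ρ) 2 (volume : Measure ℝ)
    refine (le_of_eq this).trans (mul_le_mul_right (eLpNorm_pair_le a (μ n) ha) _)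
  have hlim : ∀ᵐ ρ : ℝ, Tendsto (fun N => ∑ n ∈ Finset.range N, u n ρ) atTop (𝓝 (f ρ)) := by
    filter_upwards [hD] with ρ hρ
    rw [hsum ρ hρ]
    exact (Summable.of_norm_bounded (hc.mul_right 2) fun n => hub n ρ hρ).hasSum.tendsto_sum_nat
  have hpm : ∀ N, MemLp (fun ρ : ℝ => ∑ n ∈ Finset.range N, u n ρ) 2 volume := fun N =>
    memLp_finsetSum _ fun n _ => hmem n
  have hce : ∑' n, ‖c n‖ₑ ≠ ⊤ :=
    ENNReal.tsum_coe_ne_top_iff_summable.2 (NNReal.summable_coe.1 hc)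
  -- Fatou's lemma as the upper end of the block of terms goes to infinity; each block is controlled
  -- by the triangle inequality.
  have htail : ∀ N, eLpNorm (fun ρ : ℝ => f ρ - ∑ n ∈ Finset.range N, u n ρ) 2 volume ≤
      (∑' n, ‖c (n + N)‖ₑ) * K := fun N => by
    refine (Lp.eLpNorm_lim_le_liminf_eLpNorm (fun M => ((hpm (M + N)).sub (hpm N)).1) _ ?_).trans ?_
    · filter_upwards [hlim] with ρ hρ
      exact ((tendsto_add_atTop_iff_nat N).2 hρ).sub_const _
    refine liminf_le_of_le (by isBoundedDefault) fun b hb => ?_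
    obtain ⟨M, hM⟩ := hb.exists
    refine hM.trans ?_
    have e : ((fun ρ : ℝ => ∑ n ∈ Finset.range (M + N), u n ρ) -
        fun ρ : ℝ => ∑ n ∈ Finset.range N, u n ρ) =
        ∑ n ∈ Finset.range M, fun ρ : ℝ => u (n + N) ρ := by
      funext ρ
      simp only [Pi.sub_apply, Finset.sum_apply]
      rw [add_comm M N, Finset.sum_range_add, add_sub_cancel_left]
      exact Finset.sum_congr rfl fun n _ => by rw [add_comm]
    rw [e]
    refine (eLpNorm_sum_le (fun n _ => (hmem _).1) (by norm_num)).trans ?_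
    refine (Finset.sum_le_sum fun n _ => hnorm (n + N)).trans ?_
    rw [← ENNReal.tsum_mul_right]
    exact ENNReal.sum_le_tsum _
  have htend : Tendsto (fun N => (∑' n, ‖c (n + N)‖ₑ) * K) atTop (𝓝 0) := by
    simpa using ENNReal.Tendsto.mul_const (ENNReal.tendsto_sum_nat_add _ hce) (Or.inr hKtop)
  -- No measurability of `f` is assumed; it is an almost everywhere limit of partial sums.
  have hfm : AEStronglyMeasurable (fun ρ : ℝ => f ρ) volume :=
    aestronglyMeasurable_of_tendsto_ae atTop (fun N => (hpm N).1) hlim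
  refine ⟨fun S hS => ?_, ?_, fun ρ hρ => ?_, ?_, hmem, ?_, ?_⟩
  · obtain ⟨B, hB⟩ := hS.isBounded.exists_norm_le
    refine TendstoUniformlyOn.congr_right (tendstoUniformlyOn_tsum_nat
      (hc.mul_right (2 * Real.exp (Real.pi * (|a| * B)))) fun n ρ hρ => ?_)
      fun ρ hρ => (hsum ρ hρ.2).symm
    rw [hu n ρ hρ.2]
    exact norm_term_le _ _ _ ((Complex.abs_im_le_norm ρ).trans (hB ρ hρ.1))
  · exact TendstoUniformlyOn.congr_right (tendstoUniformlyOn_tsum_nat (hc.mul_right 2)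
      fun n ρ hρ => hub n ρ hρ) fun ρ hρ => (hsum ρ hρ).symm
  · exact .of_nonneg_of_le (fun _ => norm_nonneg _) (fun n => hub n ρ hρ) (hc.mul_right 2)
  · exact tendstoUniformlyOn_tsum_nat (hc.mul_right 2) fun n ρ hρ => by
      rw [norm_norm]; exact hub n ρ hρ
  · refine ⟨hfm, ?_⟩
    have := htail 0
    simp only [Finset.range_zero, Finset.sum_empty, sub_zero, add_zero] at this
    exact this.trans_lt (ENNReal.mul_lt_top hce.lt_top hKtop.lt_top)
  · exact tendsto_of_tendsto_of_tendsto_of_le_of_le tendsto_const_nhds htend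
      (fun _ => bot_le) htail

end Series

/-! ### Uniqueness for entire functions of exponential type -/

/-- `E / sin(π ·)`, with the removable singularities removed. -/
noncomputable def divSin (E : ℂ → ℂ) (z : ℂ) : ℂ :=
  if Complex.sin (Real.pi * z) = 0 then deriv E z / (Real.pi * Complex.cos (Real.pi * z))
  else E z / Complex.sin (Real.pi * z)

lemma hasDerivAt_sin_pi_mul (z : ℂ) :
    HasDerivAt (fun z : ℂ => Complex.sin (Real.pi * z)) (Real.pi * Complex.cos (Real.pi * z)) z := by
  have := ((hasDerivAt_id z).const_mul (Real.pi : ℂ)).csin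
  simpa [mul_comm] using this

lemma cos_ne_zero_of_sin_eq_zero {z : ℂ} (h : Complex.sin z = 0) : Complex.cos z ≠ 0 := fun h' => by
  have := Complex.sin_sq_add_cos_sq z
  simp [h, h'] at this

lemma sin_pi_mul_eq_zero_iff (z : ℂ) : Complex.sin (Real.pi * z) = 0 ↔ ∃ k : ℤ, z = k := by
  rw [Complex.sin_eq_zero_iff]
  refine exists_congr fun k => ?_
  have : (Real.pi : ℂ) ≠ 0 := by simp
  rw [mul_comm, mul_left_inj' this]

lemma differentiable_dslope {f : ℂ → ℂ} (hf : Differentiable ℂ f) (c : ℂ) :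
    Differentiable ℂ (dslope f c) := fun z =>
  ((Complex.differentiableOn_dslope univ_mem).2 hf.differentiableOn z (mem_univ z)).differentiableAt
    univ_mem

lemma differentiable_sin_pi_mul : Differentiable ℂ fun z : ℂ => Complex.sin (Real.pi * z) :=
  fun z => (hasDerivAt_sin_pi_mul z).differentiableAt

/-- Near an integer the quotient is a ratio of two difference quotients, and the lower one does not
vanish because the zeros of the sine are simple. -/
lemma differentiable_divSin {E : ℂ → ℂ} (hE : Differentiable ℂ E) (h0 : ∀ k : ℤ, E k = 0) :
    Differentiable ℂ (divSin E) := by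
  intro z
  set s := fun z : ℂ => Complex.sin (Real.pi * z) with hs
  have hsd := differentiable_sin_pi_mul
  by_cases hz : s z = 0
  · have hEz : E z = 0 := by
      obtain ⟨k, rfl⟩ := (sin_pi_mul_eq_zero_iff z).1 hz
      exact h0 k
    have hds : dslope s z z = Real.pi * Complex.cos (Real.pi * z) := by
      rw [dslope_same, (hasDerivAt_sin_pi_mul z).deriv]
    have hne : dslope s z z ≠ 0 := by
      rw [hds]
      exact mul_ne_zero (by simp) (cos_ne_zero_of_sin_eq_zero hz)
    have hev : divSin E =ᶠ[𝓝 z] fun w => dslope E z w / dslope s z w := by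
      have h1 : ∀ᶠ w in 𝓝 z, dslope s z w ≠ 0 :=
        (differentiable_dslope hsd z).continuous.continuousAt.eventually_ne hne
      filter_upwards [h1] with w hw
      by_cases hwz : w = z
      · subst hwz
        rw [hds, dslope_same, divSin, if_pos hz]
      · have h2 : w - z ≠ 0 := sub_ne_zero.2 hwz
        rw [dslope_of_ne _ hwz, slope_def_field, hz, sub_zero] at hw
        have hsw : s w ≠ 0 := fun h => hw (by rw [h, zero_div])
        rw [dslope_of_ne _ hwz, dslope_of_ne _ hwz, slope_def_field, slope_def_field, hz, hEz,
          sub_zero, sub_zero, divSin, if_neg hsw, div_div_div_cancel_right₀ h2]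
    exact ((differentiable_dslope hE z z).div (differentiable_dslope hsd z z) hne).congr_of_eventuallyEq
      hev
  · have hev : divSin E =ᶠ[𝓝 z] fun w => E w / s w := by
      filter_upwards [hsd.continuous.continuousAt.eventually_ne hz] with w hw
      rw [divSin, if_neg hw]
    exact ((hE z).div (hsd z) hz).congr_of_eventuallyEq hev

/-- For `|Im z| ≥ 1/2` the larger exponential is at least `2` and the smaller at most `1`, so their
difference is at least half the larger one. -/
lemma exp_le_norm_sin (z : ℂ) (h : 1 / 2 ≤ |z.im|) :
    Real.exp (Real.pi * |z.im|) ≤ 4 * ‖Complex.sin (Real.pi * z)‖ := by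
  have key : ∀ w : ℂ, 1 / 2 ≤ w.im →
      Real.exp (Real.pi * w.im) ≤ 4 * ‖Complex.sin (Real.pi * w)‖ := fun w hw => by
    have h1 : ‖Complex.exp (-(Real.pi * w) * Complex.I)‖ = Real.exp (Real.pi * w.im) := by
      rw [Complex.norm_exp]; simp
    have h2 : ‖Complex.exp (Real.pi * w * Complex.I)‖ = Real.exp (-(Real.pi * w.im)) := by
      rw [Complex.norm_exp]; simp
    have h3 : 2 ≤ Real.exp (Real.pi * w.im) := by
      have : 1 ≤ Real.pi * w.im := by nlinarith [Real.pi_gt_three]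
      linarith [Real.add_one_le_exp (Real.pi * w.im)]
    have h4 : Real.exp (-(Real.pi * w.im)) ≤ 1 :=
      Real.exp_le_one_iff.2 (by nlinarith [Real.pi_gt_three])
    have h5 := norm_sub_norm_le (Complex.exp (-(Real.pi * w) * Complex.I))
      (Complex.exp (Real.pi * w * Complex.I))
    rw [Complex.sin, norm_div, Complex.norm_two, norm_mul, Complex.norm_I, mul_one]
    linarith
  rcases le_or_gt 0 z.im with h0 | h0
  · rw [abs_of_nonneg h0] at h ⊢
    exact key z h
  · rw [abs_of_neg h0] at h ⊢
    have := key (-z) (by simpa using h)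
    simpa using this

lemma norm_sin_pi_sub_intCast (z : ℂ) (k : ℤ) :
    ‖Complex.sin (Real.pi * (z - k))‖ = ‖Complex.sin (Real.pi * z)‖ := by
  rw [mul_sub, mul_comm (Real.pi : ℂ) k, Complex.sin_sub, Complex.sin_int_mul_pi, mul_zero,
    sub_zero, norm_mul]
  have h1 := Complex.sin_sq_add_cos_sq (k * Real.pi)
  rw [Complex.sin_int_mul_pi, zero_pow two_ne_zero, zero_add, sq_eq_one_iff] at h1
  rcases h1 with h | h <;> simp [h]

/-- The circle of radius `3/4` contains no integer, so compactness gives a positive minimum. By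
periodicity of `|sin(π ·)|` the bound holds on such a circle about every integer. -/
lemma exists_lower_bound_sin :
    ∃ δ > 0, ∀ w : ℂ, ‖w‖ = 3 / 4 → δ ≤ ‖Complex.sin (Real.pi * w)‖ := by
  have hc : IsCompact (Metric.sphere (0 : ℂ) (3 / 4)) := isCompact_sphere _ _
  obtain ⟨w, hw, hmin⟩ := hc.exists_isMinOn (f := fun w : ℂ => ‖Complex.sin (Real.pi * w)‖)
    (NormedSpace.sphere_nonempty.2 (by norm_num))
    (differentiable_sin_pi_mul.continuous.norm.continuousOn)
  refine ⟨‖Complex.sin (Real.pi * w)‖, norm_pos_iff.2 fun h => ?_, fun v hv =>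
    hmin (by simpa using hv)⟩
  obtain ⟨k, rfl⟩ := (sin_pi_mul_eq_zero_iff w).1 h
  simp only [mem_sphere_iff_norm, sub_zero, Complex.norm_intCast] at hw
  rcases eq_or_ne k 0 with rfl | hk
  · norm_num at hw
  · have : (1 : ℝ) ≤ |(k : ℝ)| := by exact_mod_cast Int.one_le_abs hk
    linarith

/-- An entire function of exponential type `π` which vanishes at the integers and tends to zero
along the real axis vanishes identically. -/
theorem eq_zero_of_exponential_type {E : ℂ → ℂ} (hE : Differentiable ℂ E)
    (h0 : ∀ k : ℤ, E k = 0) {M : ℝ} (hM : ∀ z, ‖E z‖ ≤ M * Real.exp (Real.pi * |z.im|))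
    (hlim : Tendsto (fun x : ℝ => E x) atTop (𝓝 0)) (z : ℂ) : E z = 0 := by
  obtain ⟨δ, hδ, hsin⟩ := exists_lower_bound_sin
  have hM0 : 0 ≤ M := by simpa using (norm_nonneg _).trans (hM 0)
  have hd := differentiable_divSin hE h0
  have hb : ∀ w, ‖divSin E w‖ ≤ max (M * Real.exp (Real.pi * 1) / δ) (4 * M) := by
    intro w
    set k := round w.re
    have hre : |w.re - k| ≤ 1 / 2 := abs_sub_round w.re
    -- Inside the disc of radius `3/4` about the nearest integer the maximum principle applies.
    -- Outside it, `|Re w - k| ≤ 1/2` forces `|Im w| ≥ 1/2`, since `9/16 - 1/4 ≥ 1/4`.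
    rcases le_or_gt ‖w - k‖ (3 / 4) with hw | hw
    · refine le_max_of_le_left ?_
      refine Complex.norm_le_of_forall_mem_frontier_norm_le (U := Metric.ball (k : ℂ) (3 / 4))
        Metric.isBounded_ball hd.diffContOnCl (fun v hv => ?_) ?_
      · rw [frontier_ball _ (by norm_num), mem_sphere_iff_norm] at hv
        have h1 := hsin (v - k) hv
        rw [norm_sin_pi_sub_intCast] at h1
        have hne : Complex.sin (Real.pi * v) ≠ 0 := fun h => by
          rw [h, norm_zero] at h1; linarith
        rw [divSin, if_neg hne, norm_div]
        have him : |v.im| ≤ 1 := by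
          have := Complex.abs_im_le_norm (v - k)
          simp only [Complex.sub_im, Complex.intCast_im, sub_zero] at this
          linarith
        refine div_le_div₀ (by positivity) ((hM v).trans ?_) hδ h1
        gcongr
      · rw [closure_ball _ (by norm_num)]
        simpa [dist_eq_norm] using hw
    · refine le_max_of_le_right ?_
      have him : 1 / 2 ≤ |w.im| := by
        have h1 : ‖w - k‖ ^ 2 = (w.re - k) ^ 2 + w.im ^ 2 := by
          rw [Complex.sq_norm, Complex.normSq_apply]
          simp; ring
        have h2 : (w.re - k) ^ 2 ≤ (1 / 2) ^ 2 := by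
          rw [← sq_abs (w.re - k)]; gcongr
        refine abs_le_of_sq_le_sq' (a := 1 / 2) (b := |w.im|) ?_ (abs_nonneg _) |>.2
        rw [sq_abs]
        nlinarith
      have h1 := exp_le_norm_sin w him
      have hpos : 0 < ‖Complex.sin (Real.pi * w)‖ := by
        linarith [Real.exp_pos (Real.pi * |w.im|)]
      rw [divSin, if_neg (norm_pos_iff.1 hpos), norm_div, div_le_iff₀ hpos]
      calc ‖E w‖ ≤ M * Real.exp (Real.pi * |w.im|) := hM w
        _ ≤ M * (4 * ‖Complex.sin (Real.pi * w)‖) := by gcongr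
        _ = _ := by ring
  have hconst : ∀ w, divSin E w = divSin E 0 := fun w =>
    hd.apply_eq_apply_of_bounded (isBounded_iff_forall_norm_le.2 ⟨_, forall_mem_range.2 hb⟩) w 0
  have hE' : ∀ w, E w = divSin E 0 * Complex.sin (Real.pi * w) := fun w => by
    by_cases h : Complex.sin (Real.pi * w) = 0
    · obtain ⟨k, rfl⟩ := (sin_pi_mul_eq_zero_iff w).1 h
      rw [h0, h, mul_zero]
    · rw [← hconst w, divSin, if_neg h, div_mul_cancel₀ _ h]
  -- At the points `2n + 1/2` the sine equals `1`, so `E` takes there the constant value of the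
  -- quotient, while it tends to zero.
  have hseq : Tendsto (fun n : ℕ => (2 * n + 1 / 2 : ℝ)) atTop atTop :=
    tendsto_atTop_add_const_right _ _ (tendsto_natCast_atTop_atTop.const_mul_atTop two_pos)
  have h1 := hlim.comp hseq
  have h2 : ∀ n : ℕ, E ((2 * n + 1 / 2 : ℝ) : ℂ) = divSin E 0 := fun n => by
    rw [hE']
    have : (Real.pi : ℂ) * ((2 * n + 1 / 2 : ℝ) : ℂ) = Real.pi / 2 + n * (2 * Real.pi) := by
      push_cast; ring
    rw [this, Complex.sin_add_nat_mul_two_pi, Complex.sin_pi_div_two, mul_one]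
  have h3 : divSin E 0 = 0 :=
    tendsto_nhds_unique (tendsto_const_nhds (x := divSin E 0) (f := (atTop : Filter ℕ)))
      (h1.congr h2)
  rw [hE', h3, zero_mul]

/-! ### The free equation `y'' = -ρ² y` -/

/-- `sin(ρ t) / ρ`, with the value `t` at `ρ = 0`. -/
noncomputable def sinKernel (ρ : ℂ) (t : ℝ) : ℂ := t * normSinc (ρ * t / Real.pi)

lemma mul_sinKernel (ρ : ℂ) (t : ℝ) : ρ * sinKernel ρ t = Complex.sin (ρ * t) := by
  have hp : (Real.pi : ℂ) ≠ 0 := by simp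
  have h := mul_normSinc (ρ * t / Real.pi)
  rw [mul_div_cancel₀ _ hp] at h
  rw [← h, sinKernel]
  ring

lemma sinKernel_zero_right (ρ : ℂ) : sinKernel ρ 0 = 0 := by simp [sinKernel]

lemma sinKernel_zero_left (t : ℝ) : sinKernel 0 t = t := by simp [sinKernel, normSinc_zero]

lemma sinKernel_of_ne {ρ : ℂ} (h : ρ ≠ 0) (t : ℝ) : sinKernel ρ t = Complex.sin (ρ * t) / ρ := by
  rw [← mul_sinKernel, mul_div_cancel_left₀ _ h]

lemma abs_im_mul_ofReal (ρ : ℂ) (t : ℝ) : |(ρ * t).im| = |ρ.im| * |t| := by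
  rw [Complex.im_mul_ofReal, abs_mul]

lemma norm_cos_mul_le (ρ : ℂ) (t : ℝ) : ‖Complex.cos (ρ * t)‖ ≤ Real.exp (|ρ.im| * |t|) :=
  (norm_cos_le _).trans_eq (by rw [abs_im_mul_ofReal])

lemma norm_sin_mul_le (ρ : ℂ) (t : ℝ) : ‖Complex.sin (ρ * t)‖ ≤ Real.exp (|ρ.im| * |t|) :=
  (norm_sin_le _).trans_eq (by rw [abs_im_mul_ofReal])

lemma norm_sinKernel_le (ρ : ℂ) (t : ℝ) :
    ‖sinKernel ρ t‖ ≤ |t| * Real.exp (|ρ.im| * |t|) := by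
  have h := norm_normSinc_le (ρ * t / Real.pi)
  have e : Real.pi * |(ρ * t / Real.pi : ℂ).im| = |ρ.im| * |t| := by
    rw [Complex.div_ofReal_im, abs_div, abs_im_mul_ofReal, abs_of_pos Real.pi_pos,
      mul_div_cancel₀ _ Real.pi_ne_zero]
  rw [e] at h
  rw [sinKernel, norm_mul, Complex.norm_real, Real.norm_eq_abs]
  gcongr

lemma norm_mul_norm_sinKernel_le (ρ : ℂ) (t : ℝ) :
    ‖ρ‖ * ‖sinKernel ρ t‖ ≤ Real.exp (|ρ.im| * |t|) := by
  rw [← norm_mul, mul_sinKernel]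
  exact norm_sin_mul_le ρ t

lemma differentiable_sinKernel (t : ℝ) : Differentiable ℂ fun ρ => sinKernel ρ t := by
  have := differentiable_normSinc
  unfold sinKernel
  fun_prop

lemma continuous_sinKernel (ρ : ℂ) : Continuous (sinKernel ρ) := by
  have := continuous_normSinc
  unfold sinKernel
  fun_prop

lemma hasDerivAt_sinKernel (ρ : ℂ) (t : ℝ) :
    HasDerivAt (sinKernel ρ) (Complex.cos (ρ * t)) t := by
  by_cases h : ρ = 0
  · subst h
    have : sinKernel 0 = fun t : ℝ => (t : ℂ) := funext sinKernel_zero_left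
    rw [this]
    simpa using (hasDerivAt_id t).ofReal_comp
  · have : sinKernel ρ = fun t : ℝ => Complex.sin (ρ * t) / ρ := funext (sinKernel_of_ne h)
    rw [this]
    have h1 := ((Complex.hasDerivAt_sin (ρ * t)).comp t
      (((hasDerivAt_id t).ofReal_comp).const_mul ρ)).div_const ρ
    refine h1.congr_deriv ?_
    simp only [Complex.ofReal_one, mul_one]
    field_simp

/-- As a function of `s` this vanishes at `s = t` with slope `-1`; inserted in the Lagrange identity
on `[0, t]`, it isolates `y t` and gives the Volterra equation. -/
lemma isSol_sinKernel (ρ : ℂ) (t T : ℝ) :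
    IsSol (fun _ => -ρ ^ 2) T (fun s => sinKernel ρ (t - s))
      (fun s => -Complex.cos (ρ * ((t - s : ℝ) : ℂ))) := by
  have hsub : ∀ s : ℝ, HasDerivAt (fun s : ℝ => t - s) (-1) s := fun s => by
    simpa using (hasDerivAt_id s).const_sub t
  refine ⟨fun s _ => ?_, ?_, Eventually.of_forall fun s _ => ?_⟩
  · have := (hasDerivAt_sinKernel ρ (t - s)).scomp s (hsub s)
    simpa [Function.comp_def] using this.hasDerivWithinAt
  · apply ContDiffOn.absolutelyContinuousOnInterval
    apply ContDiff.contDiffOn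
    have h1 : ContDiff ℝ 1 fun s : ℝ => ((t - s : ℝ) : ℂ) :=
      Complex.ofRealCLM.contDiff.comp (contDiff_const.sub contDiff_id)
    exact ((Complex.contDiff_cos.restrict_scalars ℝ).comp (contDiff_const.mul h1)).neg
  · have h1 := ((Complex.hasDerivAt_cos (ρ * ((t - s : ℝ) : ℂ))).comp s
      (((hsub s).ofReal_comp).const_mul ρ)).neg
    refine h1.congr_deriv ?_
    rw [← mul_sinKernel]
    push_cast
    ring

/-! ### Volterra equation and growth of solutions -/

variable {q : ℝ → ℂ} {L : ℝ}

/-- The Volterra integral equation (variation of constants). -/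
lemma IsSol.volterra {ρ : ℂ} {y y' : ℝ → ℂ} (h : IsSol (fun t => q t - ρ ^ 2) L y y')
    {t : ℝ} (ht : t ∈ Icc 0 L) :
    IntervalIntegrable (fun s => q s * (sinKernel ρ (t - s) * y s)) volume 0 t ∧
    y t = Complex.cos (ρ * t) * y 0 + sinKernel ρ t * y' 0 +
      ∫ s in 0..t, q s * (sinKernel ρ (t - s) * y s) := by
  have := (h.mono ht).lagrange ht.1 (isSol_sinKernel ρ t t)
  simp only [sub_neg_eq_add, sub_add_cancel, sub_self, sinKernel_zero_right, sub_zero,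
    Complex.ofReal_zero, mul_zero, Complex.cos_zero] at this
  refine ⟨this.1, ?_⟩
  rw [this.2]
  ring

/-- Weighted AM–GM separates `‖q‖²` from the squared exponential. The choice of `δ` makes the first
part at most `ε/2`, and `κ` makes the second exactly `ε/2`. -/
lemma exists_rate (hf : IntervalIntegrable (fun s => ‖q s‖ ^ 2) volume 0 L)
    (hf1 : IntervalIntegrable (fun s => ‖q s‖) volume 0 L) {ε : ℝ} (hε : 0 < ε) :
    ∃ κ > 0, ∀ t ∈ Icc 0 L, ∫ s in 0..t, ‖q s‖ * Real.exp (-(κ * (t - s))) ≤ ε := by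
  set N := ∫ s in 0..L, ‖q s‖ ^ 2
  by_cases hL : L < 0
  · exact ⟨1, one_pos, fun t ht => absurd (ht.1.trans ht.2) (not_le.2 hL)⟩
  push Not at hL
  have hN : 0 ≤ N := intervalIntegral.integral_nonneg hL fun _ _ => by positivity
  set δ := ε / (N + 1) with hδ
  have hδ0 : 0 < δ := by positivity
  set κ := 1 / (2 * δ * ε) with hκ
  have hκ0 : 0 < κ := by positivity
  refine ⟨κ, hκ0, fun t ht => ?_⟩
  have hsub : uIcc 0 t ⊆ uIcc 0 L := by
    rw [uIcc_of_le ht.1, uIcc_of_le hL]; exact Icc_subset_Icc_right ht.2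
  have hft := hf.mono_set hsub
  have hf1t := hf1.mono_set hsub
  have hce : Continuous fun s : ℝ => Real.exp (-(κ * (t - s))) := by fun_prop
  have hce2 : Continuous fun s : ℝ => Real.exp (-(2 * κ * (t - s))) := by fun_prop
  have hexp : ∫ s in 0..t, Real.exp (-(2 * κ * (t - s))) ≤ 1 / (2 * κ) := by
    have hd : ∀ s ∈ uIcc 0 t, HasDerivAt (fun s : ℝ => Real.exp (-(2 * κ * (t - s))) / (2 * κ))
        (Real.exp (-(2 * κ * (t - s)))) s := fun s _ => by
      have h1 := ((((hasDerivAt_id s).const_sub t).const_mul (2 * κ)).neg.exp).div_const (2 * κ)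
      refine h1.congr_deriv ?_
      simp only [id]
      field_simp
      simp
    rw [intervalIntegral.integral_eq_sub_of_hasDerivAt hd (hce2.intervalIntegrable _ _)]
    simp only [sub_self, mul_zero, neg_zero, Real.exp_zero]
    have : 0 ≤ Real.exp (-(2 * κ * (t - 0))) / (2 * κ) := by positivity
    linarith
  have hNt : ∫ s in 0..t, ‖q s‖ ^ 2 ≤ N := by
    refine intervalIntegral.integral_mono_interval le_rfl ht.1 ht.2
      (Eventually.of_forall fun _ => by positivity) hf
  calc ∫ s in 0..t, ‖q s‖ * Real.exp (-(κ * (t - s)))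
      ≤ ∫ s in 0..t, (δ / 2 * ‖q s‖ ^ 2 + 1 / (2 * δ) * Real.exp (-(2 * κ * (t - s)))) := by
        refine intervalIntegral.integral_mono_on ht.1 (hf1t.mul_continuousOn hce.continuousOn)
          ((hft.const_mul _).add ((hce2.intervalIntegrable _ _).const_mul _)) fun s _ => ?_
        have e : Real.exp (-(2 * κ * (t - s))) = Real.exp (-(κ * (t - s))) ^ 2 := by
          rw [← Real.exp_nat_mul]; congr 1; push_cast; ring
        rw [e]
        have := sq_nonneg (δ * ‖q s‖ - Real.exp (-(κ * (t - s))))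
        have h2 : δ / 2 * ‖q s‖ ^ 2 + 1 / (2 * δ) * Real.exp (-(κ * (t - s))) ^ 2 -
          ‖q s‖ * Real.exp (-(κ * (t - s))) =
          1 / (2 * δ) * (δ * ‖q s‖ - Real.exp (-(κ * (t - s)))) ^ 2 := by
          field_simp; ring
        have h3 : 0 ≤ 1 / (2 * δ) * (δ * ‖q s‖ - Real.exp (-(κ * (t - s)))) ^ 2 := by positivity
        linarith
    _ = δ / 2 * (∫ s in 0..t, ‖q s‖ ^ 2) +
        1 / (2 * δ) * ∫ s in 0..t, Real.exp (-(2 * κ * (t - s))) := by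
        rw [intervalIntegral.integral_add (hft.const_mul _)
          ((hce2.intervalIntegrable _ _).const_mul _), intervalIntegral.integral_const_mul,
          intervalIntegral.integral_const_mul]
    _ ≤ δ / 2 * N + 1 / (2 * δ) * (1 / (2 * κ)) := by gcongr
    _ ≤ ε := by
        have h1 : δ * N ≤ ε := by
          rw [hδ, div_mul_eq_mul_div, div_le_iff₀ (by positivity)]
          nlinarith
        have h2 : 1 / (2 * δ) * (1 / (2 * κ)) = ε / 2 := by
          rw [hκ]; field_simp
        rw [h2]; linarith

/-- Exponential growth estimate for solutions, uniform in the spectral parameter. -/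
lemma exists_growth (hL : 0 ≤ L) (hf : IntervalIntegrable (fun s => ‖q s‖ ^ 2) volume 0 L)
    (hf1 : IntervalIntegrable (fun s => ‖q s‖) volume 0 L) :
    ∃ C > 0, ∀ (ρ : ℂ) (y y' : ℝ → ℂ) (A : ℝ), IsSol (fun t => q t - ρ ^ 2) L y y' →
      (∀ t ∈ Icc 0 L, ‖Complex.cos (ρ * t) * y 0 + sinKernel ρ t * y' 0‖ ≤
        A * Real.exp (|ρ.im| * t)) →
      ∀ t ∈ Icc 0 L, ‖y t‖ ≤ C * A * Real.exp (|ρ.im| * t) := by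
  -- This `ε` gives `L ε ≤ 1/2`. In the norm weighted by `exp(-(|Im ρ| + κ)t)` the Volterra operator
  -- is then a contraction with factor `1/2`, and `κ` does not depend on `ρ`.
  obtain ⟨κ, hκ, hrate⟩ := exists_rate hf hf1 (ε := 1 / (2 * (L + 1))) (by positivity)
  refine ⟨2 * Real.exp (κ * L), by positivity, fun ρ y y' A hy hA => ?_⟩
  set τ := |ρ.im|
  have hA0 : 0 ≤ A := by
    have := (norm_nonneg _).trans (hA 0 ⟨le_rfl, hL⟩)
    simpa using this
  have hcont : ContinuousOn (fun t => ‖y t‖ * Real.exp (-((τ + κ) * t))) (Icc 0 L) :=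
    hy.continuousOn.norm.mul (by fun_prop)
  obtain ⟨t₀, ht₀, hmax⟩ := isCompact_Icc.exists_isMaxOn ⟨0, le_rfl, hL⟩ hcont
  set m := ‖y t₀‖ * Real.exp (-((τ + κ) * t₀)) with hm
  have hm0 : 0 ≤ m := by positivity
  have hym : ∀ t ∈ Icc 0 L, ‖y t‖ ≤ m * Real.exp ((τ + κ) * t) := fun t ht => by
    have h1 : ‖y t‖ * Real.exp (-((τ + κ) * t)) ≤ m := hmax ht
    rwa [Real.exp_neg, ← div_eq_mul_inv, div_le_iff₀ (Real.exp_pos _)] at h1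
  obtain ⟨hint, hvol⟩ := hy.volterra ht₀
  have hce : Continuous fun s : ℝ => Real.exp (-(κ * (t₀ - s))) := by fun_prop
  have hsub : uIcc 0 t₀ ⊆ uIcc 0 L := by
    rw [uIcc_of_le ht₀.1, uIcc_of_le hL]; exact Icc_subset_Icc_right ht₀.2
  have hI : ‖∫ s in 0..t₀, q s * (sinKernel ρ (t₀ - s) * y s)‖ ≤
      L * m * Real.exp ((τ + κ) * t₀) *
        ∫ s in 0..t₀, ‖q s‖ * Real.exp (-(κ * (t₀ - s))) := by
    rw [← intervalIntegral.integral_const_mul]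
    refine intervalIntegral.norm_integral_le_of_norm_le ht₀.1 ?_
      (((hf1.mono_set hsub).mul_continuousOn hce.continuousOn).const_mul _)
    refine Eventually.of_forall fun s hs => ?_
    have h1 := norm_sinKernel_le ρ (t₀ - s)
    rw [abs_of_nonneg (sub_nonneg.2 hs.2)] at h1
    have h2 := hym s ⟨hs.1.le, hs.2.trans ht₀.2⟩
    have h3 : t₀ - s ≤ L := by linarith [hs.1, ht₀.2]
    rw [norm_mul, norm_mul]
    calc ‖q s‖ * (‖sinKernel ρ (t₀ - s)‖ * ‖y s‖)
        ≤ ‖q s‖ * ((L * Real.exp (τ * (t₀ - s))) * (m * Real.exp ((τ + κ) * s))) := by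
          gcongr
          exact h1.trans (by gcongr)
      _ = L * m * (Real.exp (τ * (t₀ - s)) * Real.exp ((τ + κ) * s)) * ‖q s‖ := by ring
      _ = L * m * (Real.exp ((τ + κ) * t₀) * Real.exp (-(κ * (t₀ - s)))) * ‖q s‖ := by
          rw [← Real.exp_add, ← Real.exp_add]; congr 3; ring
      _ = _ := by ring
  have hb : ‖y t₀‖ ≤ A * Real.exp (τ * t₀) + m / 2 * Real.exp ((τ + κ) * t₀) := by
    rw [hvol]
    refine (norm_add_le _ _).trans (add_le_add (hA t₀ ht₀) (hI.trans ?_))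
    calc _ ≤ L * m * Real.exp ((τ + κ) * t₀) * (1 / (2 * (L + 1))) := by
          gcongr; exact hrate t₀ ht₀
      _ = (L / (L + 1)) * (m / 2 * Real.exp ((τ + κ) * t₀)) := by field_simp
      _ ≤ 1 * (m / 2 * Real.exp ((τ + κ) * t₀)) := by
          gcongr; rw [div_le_one (by positivity)]; linarith
      _ = _ := one_mul _
  -- At the point of maximum the integral contributes at most `m / 2`, which is absorbed on the
  -- left.
  have hm2 : m ≤ 2 * A := by
    have h1 : m ≤ (A * Real.exp (τ * t₀) + m / 2 * Real.exp ((τ + κ) * t₀)) *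
        Real.exp (-((τ + κ) * t₀)) := by rw [hm]; gcongr
    have h2 : Real.exp (τ * t₀) * Real.exp (-((τ + κ) * t₀)) ≤ 1 := by
      rw [← Real.exp_add]
      refine Real.exp_le_one_iff.2 ?_
      have := mul_nonneg hκ.le ht₀.1
      linarith
    have h3 : Real.exp ((τ + κ) * t₀) * Real.exp (-((τ + κ) * t₀)) = 1 := by
      rw [← Real.exp_add, add_neg_cancel, Real.exp_zero]
    rw [add_mul, mul_assoc, mul_assoc, h3] at h1
    nlinarith
  intro t ht
  calc ‖y t‖ ≤ m * Real.exp ((τ + κ) * t) := hym t ht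
    _ ≤ (2 * A) * Real.exp (κ * L + τ * t) := by
        gcongr
        have := mul_le_mul_of_nonneg_left ht.2 hκ.le
        linarith
    _ = _ := by rw [Real.exp_add]; ring

/-! ### Analytic dependence on the spectral parameter -/

/-- The values at a fixed point of solutions with fixed initial data are an entire function of the
spectral parameter. -/
lemma differentiable_solution (hL : 0 ≤ L)
    (hf : IntervalIntegrable (fun s => ‖q s‖ ^ 2) volume 0 L)
    (hf1 : IntervalIntegrable (fun s => ‖q s‖) volume 0 L) {a b h : ℂ}
    {y y' u u' v v' : ℂ → ℝ → ℂ}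
    (hy : ∀ ρ, IsSol (fun t => q t - ρ ^ 2) L (y ρ) (y' ρ))
    (hy0 : ∀ ρ, y ρ 0 = a) (hy1 : ∀ ρ, y' ρ 0 = b)
    (hu : ∀ ρ, IsSol (fun t => q t - ρ ^ 2) L (u ρ) (u' ρ))
    (hu0 : ∀ ρ, u ρ 0 = 0) (hu1 : ∀ ρ, u' ρ 0 = 1)
    (hv : ∀ ρ, IsSol (fun t => q t - ρ ^ 2) L (v ρ) (v' ρ))
    (hv0 : ∀ ρ, v ρ 0 = 1) (hv1 : ∀ ρ, v' ρ 0 = h)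
    {x : ℝ} (hx : x ∈ Icc 0 L) : Differentiable ℂ fun ρ => y ρ x := by
  intro σ
  have hlag : ∀ ρ, ∀ t ∈ Icc 0 L, ∀ z z' : ℝ → ℂ, IsSol (fun t => q t - σ ^ 2) L z z' →
      (σ ^ 2 - ρ ^ 2) * ∫ s in 0..t, z s * y ρ s =
        (z t * y' ρ t - z' t * y ρ t) - (z 0 * b - z' 0 * a) := fun ρ t ht z z' hz => by
    have := (((hy ρ).mono ht).lagrange ht.1 (hz.mono ht)).2
    rw [hy0, hy1] at this
    rw [← this, ← intervalIntegral.integral_const_mul]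
    refine intervalIntegral.integral_congr fun s _ => ?_
    ring
  -- The Wronskian of the fundamental system at `σ` is constant, equal to `1`.
  have hW : ∀ t ∈ Icc 0 L, v σ t * u' σ t - v' σ t * u σ t = 1 := fun t ht => by
    have := (((hu σ).mono ht).lagrange ht.1 ((hv σ).mono ht)).2
    simp only [sub_self, zero_mul, intervalIntegral.integral_zero, hu0, hu1, hv0, hv1] at this
    linear_combination -this
  set g : ℝ → ℝ → ℂ := fun t s => u σ t * v σ s - v σ t * u σ s with hg
  have hci : ∀ t ∈ Icc 0 L, ∀ z w : ℝ → ℂ, ContinuousOn z (Icc 0 L) → ContinuousOn w (Icc 0 L) →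
      IntervalIntegrable (fun s => z s * w s) volume 0 t := fun t ht z w hz hw => by
    apply ContinuousOn.intervalIntegrable
    rw [uIcc_of_le ht.1]
    exact (hz.mul hw).mono (Icc_subset_Icc_right ht.2)
  have hgc : ∀ t, ContinuousOn (g t) (Icc 0 L) := fun t =>
    (continuousOn_const.mul (hv σ).continuousOn).sub (continuousOn_const.mul (hu σ).continuousOn)
  -- Variation of constants: the Lagrange identities against `u σ` and `v σ` form a linear system of
  -- determinant `1`, and `y' ρ t` is eliminated.
  have hrep0 : ∀ ρ, ∀ t ∈ Icc 0 L, y ρ t = (u σ t * (b - h * a) + v σ t * a) +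
      (σ ^ 2 - ρ ^ 2) * ∫ s in 0..t, g t s * y ρ s := fun ρ t ht => by
    have h1 := hlag ρ t ht _ _ (hu σ)
    have h2 := hlag ρ t ht _ _ (hv σ)
    have h3 := hW t ht
    have h4 : ∫ s in 0..t, g t s * y ρ s =
        u σ t * (∫ s in 0..t, v σ s * y ρ s) - v σ t * ∫ s in 0..t, u σ s * y ρ s := by
      rw [← intervalIntegral.integral_const_mul, ← intervalIntegral.integral_const_mul,
        ← intervalIntegral.integral_sub
          ((hci t ht _ _ (hv σ).continuousOn (hy ρ).continuousOn).const_mul _)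
          ((hci t ht _ _ (hu σ).continuousOn (hy ρ).continuousOn).const_mul _)]
      refine intervalIntegral.integral_congr fun s _ => ?_
      simp only [hg]; ring
    rw [hu0, hu1] at h1
    rw [hv0, hv1] at h2
    rw [h4]
    linear_combination -(u σ t) * h2 + (v σ t) * h1 - (y ρ t) * h3
  -- Taking `ρ = σ` identifies the free term as `y σ t`.
  have hrep : ∀ ρ, ∀ t ∈ Icc 0 L, y ρ t = y σ t +
      (σ ^ 2 - ρ ^ 2) * ∫ s in 0..t, g t s * y ρ s := fun ρ t ht => by
    have h1 := hrep0 σ t ht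
    rw [sub_self, zero_mul, add_zero] at h1
    rw [h1]
    exact hrep0 ρ t ht
  obtain ⟨C, hC, hgrow⟩ := exists_growth hL hf hf1
  set K := C * (‖a‖ + L * ‖b‖) * Real.exp ((‖σ‖ + 1) * L)
  have hK : ∀ ρ ∈ Metric.ball σ 1, ∀ t ∈ Icc 0 L, ‖y ρ t‖ ≤ K := fun ρ hρ t ht => by
    refine (hgrow ρ (y ρ) (y' ρ) (‖a‖ + L * ‖b‖) (hy ρ) (fun s hs => ?_) t ht).trans ?_
    · rw [hy0, hy1]
      have h1 := norm_cos_mul_le ρ s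
      have h2 := norm_sinKernel_le ρ s
      rw [abs_of_nonneg hs.1] at h1 h2
      refine (norm_add_le _ _).trans ?_
      rw [norm_mul, norm_mul, add_mul]
      refine add_le_add ?_ ?_
      · rw [mul_comm]; gcongr
      · calc ‖sinKernel ρ s‖ * ‖b‖ ≤ (L * Real.exp (|ρ.im| * s)) * ‖b‖ := by
              gcongr; exact h2.trans (by gcongr; exact hs.2)
          _ = _ := by ring
    · rw [Metric.mem_ball, dist_eq_norm] at hρ
      have h1 := Complex.abs_im_le_norm ρ
      have h2 := norm_le_norm_add_norm_sub' ρ σ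
      refine mul_le_mul_of_nonneg_left (Real.exp_le_exp.2 ?_) (by positivity)
      exact mul_le_mul (by linarith) ht.2 ht.1 (by positivity)
  obtain ⟨U, hU⟩ := isCompact_Icc.exists_bound_of_continuousOn (hu σ).continuousOn
  obtain ⟨V, hV⟩ := isCompact_Icc.exists_bound_of_continuousOn (hv σ).continuousOn
  have hU0 : 0 ≤ U := (norm_nonneg _).trans (hU 0 ⟨le_rfl, hL⟩)
  have hV0 : 0 ≤ V := (norm_nonneg _).trans (hV 0 ⟨le_rfl, hL⟩)
  have hK0 : 0 ≤ K := by positivity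
  have hgb : ∀ t ∈ Icc 0 L, ∀ s ∈ Icc 0 L, ‖g t s‖ ≤ 2 * U * V := fun t ht s hs => by
    refine (norm_sub_le _ _).trans ?_
    rw [norm_mul, norm_mul]
    have h1 := mul_le_mul (hU t ht) (hV s hs) (norm_nonneg _) hU0
    have h2 := mul_le_mul (hV t ht) (hU s hs) (norm_nonneg _) hV0
    linarith
  have hint : ∀ w : ℝ → ℂ, ∀ B, (∀ s ∈ Icc 0 L, ‖w s‖ ≤ B) → ∀ t ∈ Icc 0 L,
      ‖∫ s in 0..t, g t s * w s‖ ≤ 2 * U * V * B * L := fun w B hw t ht => by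
    have hB : 0 ≤ B := (norm_nonneg _).trans (hw 0 ⟨le_rfl, hL⟩)
    refine (intervalIntegral.norm_integral_le_of_norm_le_const (C := 2 * U * V * B)
      fun s hs => ?_).trans ?_
    · rw [uIoc_of_le ht.1] at hs
      have hs' : s ∈ Icc 0 L := ⟨hs.1.le, hs.2.trans ht.2⟩
      rw [norm_mul]
      exact mul_le_mul (hgb t ht s hs') (hw s hs') (norm_nonneg _) (by positivity)
    · rw [sub_zero, abs_of_nonneg ht.1]
      gcongr
      exact ht.2
  set J : ℂ → ℂ := fun ρ => ∫ s in 0..x, g x s * y ρ s with hJ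
  -- The growth bound is locally uniform in `ρ`, so `hrep` gives uniform convergence of `y ρ` to `y
  -- σ` on `[0, L]`; the difference quotient is `-(ρ + σ) J ρ`.
  have hJlim : Tendsto J (𝓝 σ) (𝓝 (J σ)) := by
    rw [tendsto_iff_norm_sub_tendsto_zero]
    have hz : Tendsto (fun ρ : ℂ => 2 * U * V * (‖σ ^ 2 - ρ ^ 2‖ * (2 * U * V * K * L)) * L)
        (𝓝 σ) (𝓝 0) := by
      have : Continuous fun ρ : ℂ =>
        2 * U * V * (‖σ ^ 2 - ρ ^ 2‖ * (2 * U * V * K * L)) * L := by fun_prop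
      simpa using this.tendsto σ
    refine squeeze_zero' (Eventually.of_forall fun _ => norm_nonneg _) ?_ hz
    filter_upwards [Metric.ball_mem_nhds σ one_pos] with ρ hρ
    have e : J ρ - J σ = ∫ s in 0..x, g x s * (y ρ s - y σ s) := by
      rw [hJ, ← intervalIntegral.integral_sub (hci x hx _ _ (hgc x) (hy ρ).continuousOn)
        (hci x hx _ _ (hgc x) (hy σ).continuousOn)]
      simp only [mul_sub]
    rw [e]
    refine hint _ _ (fun s hs => ?_) x hx
    rw [hrep ρ s hs, add_sub_cancel_left, norm_mul]
    gcongr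
    exact hint _ K (hK ρ hρ) s hs
  have hd : HasDerivAt (fun ρ => y ρ x) (-(σ + σ) * J σ) σ := by
    rw [hasDerivAt_iff_tendsto_slope]
    have h1 : Tendsto (fun ρ => -(ρ + σ) * J ρ) (𝓝[≠] σ) (𝓝 (-(σ + σ) * J σ)) := by
      refine Tendsto.mono_left ?_ nhdsWithin_le_nhds
      exact ((continuous_id.add continuous_const).neg.tendsto σ).mul hJlim
    refine h1.congr' ?_
    filter_upwards [self_mem_nhdsWithin] with ρ hρ
    have hne : ρ - σ ≠ 0 := sub_ne_zero.2 hρ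
    rw [slope_def_field, hrep ρ x hx, add_sub_cancel_left, eq_div_iff hne]
    ring
  exact hd.differentiableAt

/-! ### Asymptotics for large real `ρ` and Fourier coefficients of `q` -/

lemma intervalIntegrable_of_memLp (hL : 0 ≤ L) (hq : MemLp q 2 (volume.restrict (Icc 0 L))) :
    IntervalIntegrable q volume 0 L ∧ IntervalIntegrable (fun s => ‖q s‖ ^ 2) volume 0 L := by
  constructor
  · rw [intervalIntegrable_iff_integrableOn_Icc_of_le hL]
    exact hq.integrable (by norm_num)
  · rw [intervalIntegrable_iff_integrableOn_Icc_of_le hL]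
    exact (memLp_two_iff_integrable_sq_norm hq.1).1 hq

lemma intervalIntegrable_of_mem_Icc (hq : IntervalIntegrable q volume 0 L) {t : ℝ}
    (ht : t ∈ Icc 0 L) : IntervalIntegrable q volume 0 t := by
  refine hq.mono_set ?_
  rw [uIcc_of_le ht.1, uIcc_of_le (ht.1.trans ht.2)]
  exact Icc_subset_Icc_right ht.2

lemma IsSol.sub {p : ℝ → ℂ} {T : ℝ} {y y' z z' : ℝ → ℂ} (hy : IsSol p T y y')
    (hz : IsSol p T z z') : IsSol p T (fun t => y t - z t) (fun t => y' t - z' t) := by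
  refine ⟨fun t ht => (hy.hasDeriv t ht).sub (hz.hasDeriv t ht), hy.ac.sub hz.ac, ?_⟩
  filter_upwards [hy.eqn, hz.eqn] with t h1 h2 ht
  rw [mul_sub]
  exact (h1 ht).sub (h2 ht)

lemma norm_integral_mul_le (hq : IntervalIntegrable q volume 0 L) {t : ℝ} (ht : t ∈ Icc 0 L)
    {w : ℝ → ℂ} {B : ℝ} (hB : 0 ≤ B) (hw : ∀ s ∈ Icc 0 t, ‖w s‖ ≤ B) :
    ‖∫ s in 0..t, q s * w s‖ ≤ (∫ s in 0..L, ‖q s‖) * B := by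
  have hqt := intervalIntegrable_of_mem_Icc hq ht
  calc ‖∫ s in 0..t, q s * w s‖ ≤ ∫ s in 0..t, ‖q s‖ * B := by
        refine intervalIntegral.norm_integral_le_of_norm_le ht.1
          (Eventually.of_forall fun s hs => ?_) (hqt.norm.mul_const _)
        rw [norm_mul]
        exact mul_le_mul_of_nonneg_left (hw s ⟨hs.1.le, hs.2⟩) (norm_nonneg _)
    _ = (∫ s in 0..t, ‖q s‖) * B := intervalIntegral.integral_mul_const _ _
    _ ≤ (∫ s in 0..L, ‖q s‖) * B := by
        gcongr
        exact intervalIntegral.integral_mono_interval le_rfl ht.1 ht.2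
          (Eventually.of_forall fun _ => norm_nonneg _) hq.norm

/-- The exponentials of kernel and solution combine to `exp(|Im ρ| t)`. The constant `k` is left
free: `L` serves for all `ρ`, and `‖ρ‖⁻¹` gives decay. -/
lemma IsSol.norm_sub_le (hq : IntervalIntegrable q volume 0 L) {ρ : ℂ} {y y' : ℝ → ℂ}
    (h : IsSol (fun t => q t - ρ ^ 2) L y y') {B k : ℝ} (hB : 0 ≤ B) (hk : 0 ≤ k)
    (hy : ∀ t ∈ Icc 0 L, ‖y t‖ ≤ B * Real.exp (|ρ.im| * t))
    (hker : ∀ t ∈ Icc 0 L, ‖sinKernel ρ t‖ ≤ k * Real.exp (|ρ.im| * t)) {t : ℝ}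
    (ht : t ∈ Icc 0 L) :
    ‖y t - (Complex.cos (ρ * t) * y 0 + sinKernel ρ t * y' 0)‖ ≤
      (∫ s in 0..L, ‖q s‖) * (k * B * Real.exp (|ρ.im| * t)) := by
  rw [(h.volterra ht).2, add_sub_cancel_left]
  refine norm_integral_mul_le hq ht (by positivity) fun s hs => ?_
  rw [norm_mul]
  calc ‖sinKernel ρ (t - s)‖ * ‖y s‖
      ≤ (k * Real.exp (|ρ.im| * (t - s))) * (B * Real.exp (|ρ.im| * s)) := by
        refine mul_le_mul (hker _ ⟨sub_nonneg.2 hs.2, ?_⟩) (hy s ⟨hs.1, hs.2.trans ht.2⟩)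
          (norm_nonneg _) (by positivity)
        linarith [hs.1, ht.2]
    _ = k * B * (Real.exp (|ρ.im| * (t - s)) * Real.exp (|ρ.im| * s)) := by ring
    _ = _ := by rw [← Real.exp_add]; congr 2; ring

lemma norm_sinKernel_le_of_mem (ρ : ℂ) {t : ℝ} (ht : t ∈ Icc 0 L) :
    ‖sinKernel ρ t‖ ≤ L * Real.exp (|ρ.im| * t) := by
  have h := norm_sinKernel_le ρ t
  rw [abs_of_nonneg ht.1] at h
  exact h.trans (by gcongr; exact ht.2)

lemma norm_sinKernel_le_inv {ρ : ℂ} (hρ : ρ ≠ 0) {t : ℝ} (ht : 0 ≤ t) :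
    ‖sinKernel ρ t‖ ≤ ‖ρ‖⁻¹ * Real.exp (|ρ.im| * t) := by
  have h := norm_mul_norm_sinKernel_le ρ t
  rw [abs_of_nonneg ht] at h
  rwa [← div_eq_inv_mul, le_div_iff₀' (norm_pos_iff.2 hρ)]

lemma norm_sin_ofReal_le (r : ℝ) : ‖Complex.sin r‖ ≤ 1 := by
  simpa using norm_sin_le r

/-- First order asymptotics of a solution for large real spectral parameter. -/
lemma IsSol.norm_mul_sub_integral_le (hq : IntervalIntegrable q volume 0 L) {ρ : ℝ} (hρ : 0 < ρ)
    {y y' : ℝ → ℂ} (h : IsSol (fun t => q t - (ρ : ℂ) ^ 2) L y y') {B : ℝ} (hB : 0 ≤ B)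
    (hy : ∀ t ∈ Icc 0 L, ‖y t‖ ≤ B) {x : ℝ} (hx : x ∈ Icc 0 L) :
    ‖ρ * (y x - (Complex.cos (ρ * x) * y 0 + sinKernel ρ x * y' 0)) -
        ∫ s in 0..x, q s * (Complex.sin (ρ * ((x - s : ℝ) : ℂ)) *
          (Complex.cos (ρ * s) * y 0 + sinKernel ρ s * y' 0))‖ ≤
      (∫ s in 0..L, ‖q s‖) ^ 2 * B / ρ := by
  have hL : 0 ≤ L := hx.1.trans hx.2
  set y₀ : ℝ → ℂ := fun s => Complex.cos (ρ * s) * y 0 + sinKernel ρ s * y' 0 with hy₀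
  have hy₀c : Continuous y₀ := by
    have := continuous_sinKernel ρ
    rw [hy₀]; fun_prop
  have hqx := intervalIntegrable_of_mem_Icc hq hx
  have hint : ∀ w : ℝ → ℂ, ContinuousOn w (Icc 0 L) → IntervalIntegrable
      (fun s => q s * (Complex.sin (ρ * ((x - s : ℝ) : ℂ)) * w s)) volume 0 x := fun w hw => by
    refine hqx.mul_continuousOn ?_
    rw [uIcc_of_le hx.1]
    have hs : Continuous fun s : ℝ => Complex.sin (ρ * ((x - s : ℝ) : ℂ)) := by fun_prop
    exact hs.continuousOn.mul (hw.mono (Icc_subset_Icc_right hx.2))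
  -- The kernel times `ρ` is a bounded sine, and `y - y₀` is already `O(1/ρ)`, so replacing `y` by
  -- `y₀` costs `O(1/ρ)`.
  have e : ρ * (y x - y₀ x) - ∫ s in 0..x, q s * (Complex.sin (ρ * ((x - s : ℝ) : ℂ)) * y₀ s) =
      ∫ s in 0..x, q s * (Complex.sin (ρ * ((x - s : ℝ) : ℂ)) * (y s - y₀ s)) := by
    have h1 : ρ * (y x - y₀ x) = ∫ s in 0..x, q s * (Complex.sin (ρ * ((x - s : ℝ) : ℂ)) * y s) := by
      rw [hy₀, (h.volterra hx).2, add_sub_cancel_left, ← intervalIntegral.integral_const_mul]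
      refine intervalIntegral.integral_congr fun s _ => ?_
      simp only [← mul_sinKernel]
      ring
    rw [h1, ← intervalIntegral.integral_sub (hint _ h.continuousOn) (hint _ hy₀c.continuousOn)]
    refine intervalIntegral.integral_congr fun s _ => ?_
    ring
  change ‖ρ * (y x - y₀ x) - ∫ s in 0..x, q s * (Complex.sin (ρ * ((x - s : ℝ) : ℂ)) * y₀ s)‖ ≤ _
  rw [e]
  have hQ : 0 ≤ ∫ s in 0..L, ‖q s‖ := intervalIntegral.integral_nonneg hL fun _ _ => norm_nonneg _
  have hdiff : ∀ s ∈ Icc 0 L, ‖y s - y₀ s‖ ≤ (∫ s in 0..L, ‖q s‖) * (ρ⁻¹ * B) := fun s hs => by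
    have hne : (ρ : ℂ) ≠ 0 := by exact_mod_cast hρ.ne'
    have := h.norm_sub_le hq hB (k := ρ⁻¹) (by positivity) (by simpa using hy) (fun t ht => by
      have := norm_sinKernel_le_inv hne ht.1
      rwa [Complex.norm_real, Real.norm_of_nonneg hρ.le] at this) hs
    simpa using this
  refine (norm_integral_mul_le hq hx (B := (∫ s in 0..L, ‖q s‖) * (ρ⁻¹ * B)) (by positivity)
    fun s hs => ?_).trans (le_of_eq (by ring))
  rw [norm_mul, ← Complex.ofReal_mul]
  calc _ ≤ 1 * ((∫ s in 0..L, ‖q s‖) * (ρ⁻¹ * B)) :=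
        mul_le_mul (norm_sin_ofReal_le _) (hdiff s ⟨hs.1, hs.2.trans hx.2⟩) (norm_nonneg _)
          zero_le_one
    _ = _ := one_mul _

/-- The sine coefficients of a square integrable function are square summable. -/
lemma summable_sq_sin_coeff {x : ℝ} (hx : 0 < x) (hq : MemLp q 2 (volume.restrict (Icc 0 x))) :
    Summable fun m : ℕ => ‖∫ s in 0..x, q s * Complex.sin (m * Real.pi / x * s)‖ ^ 2 := by
  have h2x : (0 : ℝ) < 2 * x := by positivity
  -- Extension by zero to length `2x` makes the Fourier frequencies `mπ/x`, of either parity of `m`.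
  set f : ℝ → ℂ := (Ioc 0 x).indicator q with hf
  have hqI : MemLp q 2 (volume.restrict (Ioc 0 x)) :=
    hq.mono_measure (Measure.restrict_mono_set _ Ioc_subset_Icc_self)
  have hfL : MemLp f 2 (volume.restrict (Ioc 0 (2 * x))) := by
    have : MemLp f 2 volume := (memLp_indicator_iff_restrict measurableSet_Ioc).2 hqI
    exact this.restrict _
  have hsum := (hasSum_sq_fourierCoeffOn h2x hfL).summable
  set β : ℤ → ℂ := fun m => ∫ s in 0..x, q s * Complex.exp (m * Real.pi / x * s * Complex.I) with hβ
  have hcoef : ∀ m : ℤ, fourierCoeffOn h2x f m = (1 / (2 * x) : ℝ) * β (-m) := fun m => by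
    rw [fourierCoeffOn_eq_integral, sub_zero, Complex.real_smul]
    congr 1
    simp only [hβ]
    rw [intervalIntegral.integral_of_le h2x.le, intervalIntegral.integral_of_le hx.le,
      setIntegral_eq_of_subset_of_forall_sdiff_eq_zero measurableSet_Ioc
        (Ioc_subset_Ioc_right (by linarith : x ≤ 2 * x)) (fun s hs => ?_)]
    · refine setIntegral_congr_fun measurableSet_Ioc fun s hs => ?_
      have h1 : (x : ℂ) ≠ 0 := by exact_mod_cast hx.ne'
      simp only [hf, indicator_of_mem hs, fourier_coe_apply, smul_eq_mul]
      rw [mul_comm]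
      congr 2
      push_cast
      field_simp
    · simp [hf, indicator_of_notMem hs.2]
  have hβs : Summable fun m : ℤ => ‖β m‖ ^ 2 := by
    have h1 : Summable fun m : ℤ => ‖β (-m)‖ ^ 2 := by
      refine (hsum.mul_left ((2 * x) ^ 2)).congr fun m => ?_
      rw [hcoef, norm_mul, Complex.norm_real, Real.norm_of_nonneg (by positivity)]
      field_simp
    exact ((Equiv.neg ℤ).summable_iff.2 h1).congr fun m => by simp
  have hqi : IntervalIntegrable q volume 0 x := (intervalIntegrable_of_memLp hx.le hq).1
  have hsin : ∀ m : ℕ, ∫ s in 0..x, q s * Complex.sin (m * Real.pi / x * s) =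
      (β (-m) - β m) * (Complex.I / 2) := fun m => by
    have hi : ∀ k : ℤ, IntervalIntegrable
        (fun s : ℝ => q s * Complex.exp (k * Real.pi / x * s * Complex.I)) volume 0 x := fun k => by
      refine hqi.mul_continuousOn (Continuous.continuousOn ?_)
      fun_prop
    rw [hβ, ← intervalIntegral.integral_sub (hi _) (hi _), ← intervalIntegral.integral_mul_const]
    refine intervalIntegral.integral_congr fun s _ => ?_
    simp only [Complex.sin]
    push_cast
    rw [show -(m * Real.pi / x * s : ℂ) = -m * Real.pi / x * s by ring]
    ring
  have hn : Summable fun m : ℕ => ‖β m‖ ^ 2 := hβs.comp_injective Nat.cast_injective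
  have hn' : Summable fun m : ℕ => ‖β (-m)‖ ^ 2 :=
    hβs.comp_injective (i := fun m : ℕ => -(m : ℤ)) (neg_injective.comp Nat.cast_injective)
  refine .of_nonneg_of_le (fun _ => by positivity) (fun m => ?_) (hn'.add hn)
  rw [hsin, norm_mul, norm_div, Complex.norm_I, Complex.norm_two]
  have h1 := norm_sub_le (β (-m)) (β m)
  have h2 := norm_nonneg (β (-m) - β m)
  nlinarith [sq_nonneg (‖β (-m)‖ - ‖β m‖)]

/-- AM–GM gives `g/r ≤ g² + 1/r²`, and `r` grows at least linearly. -/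
lemma summable_of_le_div_add {c : ℕ → ℂ} {g r : ℕ → ℝ} {x K : ℝ} (hx : 0 < x) (hK : 0 ≤ K)
    (hg : Summable fun n => g n ^ 2) (hr : ∀ n, 1 ≤ n → n / x ≤ r n)
    (hc : ∀ n, 1 ≤ n → ‖c n‖ ≤ g n / r n + K / r n ^ 2) : Summable fun n => ‖c n‖ := by
  have h2 : Summable fun n : ℕ => 1 / (n : ℝ) ^ 2 := Real.summable_one_div_nat_pow.2 one_lt_two
  refine .of_norm_bounded_eventually_nat (hg.add (h2.mul_left ((1 + K) * x ^ 2))) ?_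
  filter_upwards [eventually_ge_atTop 1] with n hn
  have hn0 : (0 : ℝ) < n := by exact_mod_cast hn
  have hpos : 0 < n / x := by positivity
  have hrn := hr n hn
  have hr0 : 0 < r n := hpos.trans_le hrn
  have h3 : 1 / r n ^ 2 ≤ x ^ 2 * (1 / (n : ℝ) ^ 2) := by
    calc 1 / r n ^ 2 ≤ 1 / (n / x) ^ 2 := by gcongr
      _ = _ := by field_simp
  have h4 : g n / r n ≤ g n ^ 2 + 1 / r n ^ 2 := by
    have := sq_nonneg (g n - 1 / r n)
    have e : (1 / r n) ^ 2 = 1 / r n ^ 2 := by rw [div_pow, one_pow]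
    have e2 : g n / r n = g n * (1 / r n) := by ring
    rw [← e, e2]
    nlinarith [sq_nonneg (g n), sq_nonneg (1 / r n)]
  rw [norm_norm]
  calc ‖c n‖ ≤ g n / r n + K / r n ^ 2 := hc n hn
    _ ≤ g n ^ 2 + 1 / r n ^ 2 + K * (1 / r n ^ 2) := by
        rw [mul_one_div]; linarith
    _ = g n ^ 2 + (1 + K) * (1 / r n ^ 2) := by ring
    _ ≤ g n ^ 2 + (1 + K) * (x ^ 2 * (1 / (n : ℝ) ^ 2)) := by gcongr
    _ = _ := by ring

/-! ### Interpolation at equally spaced nodes and sinc identities -/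

lemma pair_neg (a μ : ℝ) (ρ : ℂ) : pair a μ (-ρ) = pair a μ ρ := by
  unfold pair
  rw [← normSinc_neg (a * -ρ - μ), ← normSinc_neg (a * -ρ + μ), add_comm]
  congr 2 <;> ring

/-- An entire function of exponential type `x` tending to zero along the real axis is determined
by its values at the points `π (k + δ) / x`. -/
theorem eq_tsum_pair {x : ℝ} (hx : 0 < x) {μ : ℕ → ℝ} {c : ℕ → ℂ} (hc : Summable fun n => ‖c n‖)
    {F : ℂ → ℂ} (hF : Differentiable ℂ F) {K : ℝ}
    (hK : ∀ ρ, ‖F ρ‖ ≤ K * Real.exp (|ρ.im| * x))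
    (hlim : Tendsto (fun r : ℝ => F r) atTop (𝓝 0)) (δ : ℝ)
    (hnode : ∀ k : ℤ, F ((Real.pi / x * (k + δ) : ℝ)) =
      ∑' n, c n * pair (x / Real.pi) (μ n) ((Real.pi / x * (k + δ) : ℝ))) (ρ : ℂ) :
    F ρ = ∑' n, c n * pair (x / Real.pi) (μ n) ρ := by
  have hπ := Real.pi_pos
  set G : ℂ → ℂ := fun ρ => ∑' n, c n * pair (x / Real.pi) (μ n) ρ with hG
  have hGd : Differentiable ℂ G := differentiable_tsum_term hc
  -- This affine map carries the integers to the nodes and turns type `x` into type `π`.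
  set ℓ : ℂ → ℂ := fun w => ((Real.pi / x : ℝ) : ℂ) * (w + δ) with hℓ
  have hℓd : Differentiable ℂ ℓ := by rw [hℓ]; fun_prop
  have hℓim : ∀ w, |(ℓ w).im| * x = Real.pi * |w.im| := fun w => by
    have : (ℓ w).im = Real.pi / x * w.im := by
      simp only [hℓ]; rw [Complex.im_ofReal_mul]; simp
    rw [this, abs_mul, abs_of_pos (by positivity)]
    field_simp
  have key := eq_zero_of_exponential_type (E := fun w => F (ℓ w) - G (ℓ w))
    (M := K + (∑' n, ‖c n‖) * 2)
    ((hF.comp hℓd).sub (hGd.comp hℓd)) (fun k => ?_) (fun w => ?_) ?_ (x / Real.pi * ρ - δ)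
  · have e : ℓ (x / Real.pi * ρ - δ) = ρ := by
      have h1 : (x : ℂ) ≠ 0 := by exact_mod_cast hx.ne'
      have h2 : (Real.pi : ℂ) ≠ 0 := by simp
      simp only [hℓ]; push_cast; field_simp; ring
    rw [e] at key
    exact sub_eq_zero.1 key
  · have := hnode k
    push_cast at this
    simp only [hℓ, hG]
    push_cast
    rw [this, sub_self]
  · refine (norm_sub_le _ _).trans ?_
    have h1 := hK (ℓ w)
    have h2 := norm_tsum_term_le (a := x / Real.pi) (μ := μ) hc (ℓ w)
    have h3 : Real.pi * (|x / Real.pi| * |(ℓ w).im|) = |(ℓ w).im| * x := by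
      rw [abs_of_pos (by positivity)]; field_simp
    rw [h3, hℓim] at h2
    rw [hℓim] at h1
    rw [add_mul]
    exact add_le_add h1 h2
  · have hl : Tendsto (fun t : ℝ => Real.pi / x * (t + δ)) atTop atTop :=
      (tendsto_atTop_add_const_right _ _ tendsto_id).const_mul_atTop (by positivity)
    have h1 := (hlim.comp hl).sub ((tendsto_tsum_term_ofReal (μ := μ)
      (by positivity : 0 < x / Real.pi) hc).comp hl)
    rw [sub_zero] at h1
    refine h1.congr fun t => ?_
    simp [hℓ, hG]

lemma neg_mul_sphericalBesselJOne (z : ℂ) :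
    -(z * sphericalBesselJOne z) = Complex.cos z - normSinc (z / Real.pi) := by
  have hp : (Real.pi : ℂ) ≠ 0 := by simp
  by_cases h : z = 0
  · simp [h, normSinc]
  · rw [sphericalBesselJOne, if_neg h, normSinc, if_neg (div_ne_zero h hp), mul_div_cancel₀ _ hp]
    field_simp
    ring

lemma cos_pi_mul_normSinc_half (z : ℂ) :
    normSinc z = normSinc (z / 2) * Complex.cos (Real.pi * (z / 2)) := by
  by_cases h : z = 0
  · simp [h, normSinc]
  · have hp : (Real.pi : ℂ) ≠ 0 := by simp
    have e : (Real.pi : ℂ) * z = 2 * (Real.pi * (z / 2)) := by ring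
    rw [normSinc, normSinc, if_neg h, if_neg (div_ne_zero h two_ne_zero), e, Complex.sin_two_mul]
    field_simp

lemma sin_cos_odd_half_pi (n : ℕ) :
    Complex.sin ((2 * n + 1) / 2 * Real.pi) = (-1) ^ n ∧
    Complex.cos ((2 * n + 1) / 2 * Real.pi) = 0 := by
  have e : ((2 * n + 1) / 2 * Real.pi : ℂ) = n * Real.pi + Real.pi / 2 := by ring
  rw [e, Complex.sin_add_pi_div_two, Complex.cos_add_pi_div_two]
  constructor
  · exact_mod_cast congrArg Complex.ofReal (Real.cos_nat_mul_pi n)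
  · rw [Complex.sin_nat_mul_pi, neg_zero]

/-- The double-angle formula splits each sinc into a half-argument sinc times a cosine, which at odd
centres is `± sin(ρx)`; this leaves `A - B`. The numerators of `A` and `B` are opposite, so `(ρx -
θ)A + (ρx + θ)B = 0` with `θ = (2n+1)π/2`, and `A - B` becomes a multiple of `A + B`. -/
lemma oddSincPair_eq (x : ℝ) (n : ℕ) (ρ : ℂ) :
    oddSincPair x n ρ = 2 * ρ * Complex.sin (ρ * x) *
      (x / Real.pi * ((-1) ^ n / (2 * n + 1)) * pair (x / Real.pi) (n + 1 / 2) ρ) := by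
  have hp : (Real.pi : ℂ) ≠ 0 := by simp
  have hm : (2 * n + 1 : ℂ) ≠ 0 := by exact_mod_cast Nat.succ_ne_zero (2 * n)
  obtain ⟨hs, hc⟩ := sin_cos_odd_half_pi n
  set A := normSinc ((2 * ρ * x / Real.pi - 2 * n - 1) / 2) with hA
  set B := normSinc ((2 * ρ * x / Real.pi + 2 * n + 1) / 2) with hB
  have e1 : (Real.pi : ℂ) * ((2 * ρ * x / Real.pi - 2 * n - 1) / 2) =
      ρ * x - (2 * n + 1) / 2 * Real.pi := by field_simp; ring
  have e2 : (Real.pi : ℂ) * ((2 * ρ * x / Real.pi + 2 * n + 1) / 2) =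
      ρ * x + (2 * n + 1) / 2 * Real.pi := by field_simp; ring
  have h1 : oddSincPair x n ρ = Complex.sin (ρ * x) * (-1) ^ n * (A - B) := by
    rw [oddSincPair, cos_pi_mul_normSinc_half, cos_pi_mul_normSinc_half (_ + 1), e1, e2,
      Complex.cos_sub, Complex.cos_add, hs, hc]
    ring
  have hpair : pair (x / Real.pi) (n + 1 / 2) ρ = A + B := by
    rw [pair, hA, hB]
    congr 2 <;> (push_cast; field_simp; ring)
  have h2 := mul_normSinc ((2 * ρ * x / Real.pi - 2 * n - 1) / 2)
  have h3 := mul_normSinc ((2 * ρ * x / Real.pi + 2 * n + 1) / 2)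
  rw [← hA, e1, Complex.sin_sub, hs, hc] at h2
  rw [← hB, e2, Complex.sin_add, hs, hc] at h3
  have h4 : (2 * n + 1) * Real.pi * (A - B) = 2 * ρ * x * (A + B) := by
    linear_combination (-2) * h2 - 2 * h3
  rw [h1, hpair]
  field_simp
  linear_combination Complex.sin (ρ * x) * h4

lemma sincPair_eq (x : ℝ) (n : ℕ) (ρ : ℂ) : sincPair x n ρ = pair (x / Real.pi) n ρ := by
  rw [sincPair, pair]
  congr 2 <;> (push_cast; ring)

lemma oddSincPair_eq_pair (x : ℝ) (n : ℕ) (ρ : ℂ) :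
    oddSincPair x n ρ = pair (2 * x / Real.pi) (2 * n + 1) ρ := by
  rw [oddSincPair, pair]
  congr 2 <;> (push_cast; ring)

lemma normSinc_intCast_eq (k : ℤ) : normSinc k = if k = 0 then 1 else 0 := by
  split_ifs with h
  · simp [h, normSinc]
  · exact normSinc_intCast k h

/-- At the node `0` both halves of the pair `n = 0` equal `1`; hence the factor `2`, offset by the
half in `φ_0`. -/
lemma tsum_pair_int_node {x : ℝ} (hx : 0 < x) (c : ℕ → ℂ) (k : ℕ) :
    ∑' n : ℕ, c n * pair (x / Real.pi) n ((Real.pi / x * k : ℝ)) =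
      if k = 0 then 2 * c 0 else c k := by
  have hp := Real.pi_pos
  have e : ∀ n : ℕ, pair (x / Real.pi) n ((Real.pi / x * k : ℝ)) =
      (if n = k then 1 else 0) + (if k = 0 ∧ n = 0 then 1 else 0) := fun n => by
    have h1 : (x : ℂ) ≠ 0 := by exact_mod_cast hx.ne'
    have h2 : (Real.pi : ℂ) ≠ 0 := by simp
    have e1 : ((x / Real.pi : ℝ) : ℂ) * ((Real.pi / x * k : ℝ) : ℂ) - ((n : ℝ) : ℂ) =
      ((k - n : ℤ) : ℂ) := by push_cast; field_simp
    have e2 : ((x / Real.pi : ℝ) : ℂ) * ((Real.pi / x * k : ℝ) : ℂ) + ((n : ℝ) : ℂ) =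
      ((k + n : ℤ) : ℂ) := by push_cast; field_simp
    rw [pair, e1, e2, normSinc_intCast_eq, normSinc_intCast_eq]
    congr 1
    · exact if_congr (by omega) rfl rfl
    · exact if_congr (by omega) rfl rfl
  rw [tsum_eq_single k fun n hn => ?_]
  · rw [e]
    by_cases hk : k = 0
    · subst hk; simp; ring
    · simp [hk]
  · rw [e, if_neg hn, if_neg (by omega)]
    simp

/-- The second sinc has argument `k + n + 1`, which is never zero, so no node counts twice. -/
lemma tsum_pair_half_node {x : ℝ} (hx : 0 < x) (c : ℕ → ℂ) (k : ℕ) :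
    ∑' n : ℕ, c n * pair (x / Real.pi) (n + 1 / 2) ((Real.pi / x * (k + 1 / 2) : ℝ)) = c k := by
  have hp := Real.pi_pos
  have e : ∀ n : ℕ, pair (x / Real.pi) (n + 1 / 2) ((Real.pi / x * (k + 1 / 2) : ℝ)) =
      if n = k then 1 else 0 := fun n => by
    have h1 : (x : ℂ) ≠ 0 := by exact_mod_cast hx.ne'
    have h2 : (Real.pi : ℂ) ≠ 0 := by simp
    have e1 : ((x / Real.pi : ℝ) : ℂ) * ((Real.pi / x * (k + 1 / 2) : ℝ) : ℂ) -
      ((n + 1 / 2 : ℝ) : ℂ) = ((k - n : ℤ) : ℂ) := by push_cast; field_simp; ring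
    have e2 : ((x / Real.pi : ℝ) : ℂ) * ((Real.pi / x * (k + 1 / 2) : ℝ) : ℂ) +
      ((n + 1 / 2 : ℝ) : ℂ) = ((k + n + 1 : ℤ) : ℂ) := by push_cast; field_simp; ring
    rw [pair, e1, e2, normSinc_intCast_eq, normSinc_intCast_eq, if_neg (c := _ + _ = _) (by omega),
      add_zero]
    exact if_congr (by omega) rfl rfl
  rw [tsum_eq_single k fun n hn => by rw [e, if_neg hn, mul_zero], e, if_pos rfl, mul_one]

lemma ae_sin_ne_zero {x : ℝ} (hx : 0 < x) : ∀ᵐ ρ : ℝ, Complex.sin ((ρ : ℂ) * x) ≠ 0 := by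
  have hc : (range fun k : ℤ => k * Real.pi / x).Countable := countable_range _
  filter_upwards [hc.ae_notMem volume] with ρ hρ h0
  rw [← Complex.ofReal_mul, ← Complex.ofReal_sin, Complex.ofReal_eq_zero, Real.sin_eq_zero_iff] at h0
  obtain ⟨k, hk⟩ := h0
  exact hρ ⟨k, by simp only [hk]; exact mul_div_cancel_right₀ _ hx.ne'⟩

lemma eventually_sin_ne_zero {x : ℝ} (hx : 0 < x) (ρ : ℂ) :
    ∀ᶠ z in 𝓝[≠] ρ, Complex.sin (z * x) ≠ 0 := by
  have ha : AnalyticOnNhd ℂ (fun z : ℂ => Complex.sin (z * x)) univ := fun z _ => by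
    have : Differentiable ℂ fun z : ℂ => Complex.sin (z * x) :=
      Complex.differentiable_sin.comp (differentiable_id.mul_const _)
    exact this.analyticAt z
  rcases (ha ρ (mem_univ _)).eventually_eq_zero_or_eventually_ne_zero with h | h
  · exfalso
    have h1 := ha.eqOn_zero_of_preconnected_of_eventuallyEq_zero isPreconnected_univ (mem_univ ρ) h
    have h2 := h1 (mem_univ ((Real.pi / 2 / x : ℝ) : ℂ))
    have hx' : (x : ℂ) ≠ 0 := by exact_mod_cast hx.ne'
    simp only [Complex.ofReal_div, Pi.zero_apply] at h2
    rw [div_mul_cancel₀ _ hx'] at h2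
    simp at h2
  · exact h

/-- Uniqueness: the growth estimate with `A = 0` kills the difference. It yields evenness in `ρ`, as
the equation contains only `ρ²`. -/
lemma IsSol.eq_of_sq_eq (hL : 0 ≤ L) (hq : MemLp q 2 (volume.restrict (Icc 0 L))) {ρ σ : ℂ}
    (hσ : σ ^ 2 = ρ ^ 2) {y y' z z' : ℝ → ℂ} (hy : IsSol (fun t => q t - ρ ^ 2) L y y')
    (hz : IsSol (fun t => q t - σ ^ 2) L z z') (h0 : y 0 = z 0) (h1 : y' 0 = z' 0) {t : ℝ}
    (ht : t ∈ Icc 0 L) : y t = z t := by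
  obtain ⟨hqi, hq2⟩ := intervalIntegrable_of_memLp hL hq
  obtain ⟨C, -, hC⟩ := exists_growth hL hq2 hqi.norm
  rw [hσ] at hz
  have := hC ρ _ _ 0 (hy.sub hz) (fun s _ => by simp [h0, h1]) t ht
  simpa [sub_eq_zero] using this

/-- The `-2` is the contribution of the free solution, because `sin(ρx) = (-1)^n` at the node. -/
lemma sCoeff_eq (S : ℂ → ℝ → ℂ) {x : ℝ} (hx : 0 < x) (n : ℕ) :
    sCoeff S x n = 2 * (-1) ^ n * ((Real.pi / x * (n + 1 / 2) : ℝ) : ℂ) *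
      (S ((Real.pi / x * (n + 1 / 2) : ℝ) : ℂ) x -
        sinKernel ((Real.pi / x * (n + 1 / 2) : ℝ) : ℂ) x) := by
  have hx' : (x : ℂ) ≠ 0 := by exact_mod_cast hx.ne'
  have e : ((Real.pi / x * (n + 1 / 2) : ℝ) : ℂ) = (2 * n + 1) / (2 * x) * Real.pi := by
    push_cast; field_simp
  have h1 := mul_sinKernel ((Real.pi / x * (n + 1 / 2) : ℝ) : ℂ) x
  have e2 : ((Real.pi / x * (n + 1 / 2) : ℝ) : ℂ) * x = (2 * n + 1) / 2 * Real.pi := by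
    push_cast; field_simp
  rw [e2, (sin_cos_odd_half_pi n).1] at h1
  have hpow : ((-1 : ℂ) ^ n) * (-1) ^ n = 1 := by rw [← mul_pow]; simp
  rw [mul_sub, mul_assoc _ _ (sinKernel _ _), h1, mul_assoc 2 ((-1) ^ n) ((-1) ^ n), hpow, sCoeff, e]
  field_simp

/-- The cosine vanishes at the right end, so the product collapses to one sine of odd index; at
integer nodes the sine vanishes instead and the index is even. -/
lemma sin_odd_half_mul_sub {x : ℝ} (hx : 0 < x) (n : ℕ) (s : ℝ) :
    Complex.sin (((Real.pi / x * (n + 1 / 2) : ℝ) : ℂ) * ((x - s : ℝ) : ℂ)) *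
      Complex.sin (((Real.pi / x * (n + 1 / 2) : ℝ) : ℂ) * s) =
    (-1) ^ n / 2 * Complex.sin ((2 * n + 1 : ℕ) * Real.pi / x * s) := by
  have hx' : (x : ℂ) ≠ 0 := by exact_mod_cast hx.ne'
  obtain ⟨h1, h2⟩ := sin_cos_odd_half_pi n
  have e : ((Real.pi / x * (n + 1 / 2) : ℝ) : ℂ) * ((x - s : ℝ) : ℂ) =
      (2 * n + 1) / 2 * Real.pi - ((Real.pi / x * (n + 1 / 2) : ℝ) : ℂ) * s := by
    push_cast; field_simp
  have e2 : (((2 * n + 1 : ℕ) : ℂ) * Real.pi / x * s) =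
      2 * (((Real.pi / x * (n + 1 / 2) : ℝ) : ℂ) * s) := by
    push_cast; field_simp
  rw [e, e2, Complex.sin_sub, Complex.sin_two_mul, h1, h2]
  ring

lemma sin_int_mul_sub {x : ℝ} (hx : 0 < x) (n : ℕ) (s : ℝ) :
    Complex.sin (((Real.pi / x * n : ℝ) : ℂ) * ((x - s : ℝ) : ℂ)) *
      Complex.cos (((Real.pi / x * n : ℝ) : ℂ) * s) =
    -((-1) ^ n / 2) * Complex.sin ((2 * n : ℕ) * Real.pi / x * s) := by
  have hx' : (x : ℂ) ≠ 0 := by exact_mod_cast hx.ne'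
  have hc : Complex.cos (n * Real.pi) = (-1) ^ n := by
    exact_mod_cast congrArg Complex.ofReal (Real.cos_nat_mul_pi n)
  have e : ((Real.pi / x * n : ℝ) : ℂ) * ((x - s : ℝ) : ℂ) =
      n * Real.pi - ((Real.pi / x * n : ℝ) : ℂ) * s := by
    push_cast; field_simp
  have e2 : (((2 * n : ℕ) : ℂ) * Real.pi / x * s) = 2 * (((Real.pi / x * n : ℝ) : ℂ) * s) := by
    push_cast; field_simp
  rw [e, e2, Complex.sin_sub, Complex.sin_two_mul, hc, Complex.sin_nat_mul_pi]
  ring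

/-! ### Expansion of `S` -/

section Sine

variable {S S' : ℂ → ℝ → ℂ} {x : ℝ}

lemma exists_bound_sine (hL : 0 ≤ L) (hq : MemLp q 2 (volume.restrict (Icc 0 L)))
    (hS : ∀ ρ, IsSol (fun t => q t - ρ ^ 2) L (S ρ) (S' ρ)) (hS0 : ∀ ρ, S ρ 0 = 0)
    (hS1 : ∀ ρ, S' ρ 0 = 1) :
    ∃ C > 0, ∀ ρ k, (∀ t ∈ Icc 0 L, ‖sinKernel ρ t‖ ≤ k * Real.exp (|ρ.im| * t)) →
      ∀ t ∈ Icc 0 L, ‖S ρ t‖ ≤ C * k * Real.exp (|ρ.im| * t) := by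
  obtain ⟨hqi, hq2⟩ := intervalIntegrable_of_memLp hL hq
  obtain ⟨C, hC, h⟩ := exists_growth hL hq2 hqi.norm
  exact ⟨C, hC, fun ρ k hk => h ρ _ _ k (hS ρ) fun t ht => by
    rw [hS0, hS1, mul_zero, zero_add, mul_one]; exact hk t ht⟩

lemma summable_sCoeff (hq : MemLp q 2 (volume.restrict (Icc 0 L)))
    (hS : ∀ ρ, IsSol (fun t => q t - ρ ^ 2) L (S ρ) (S' ρ)) (hS0 : ∀ ρ, S ρ 0 = 0)
    (hS1 : ∀ ρ, S' ρ 0 = 1) (hx : x ∈ Ioc 0 L) : Summable fun n => ‖sCoeff S x n‖ := by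
  have hL : 0 ≤ L := hx.1.le.trans hx.2
  have hxI : x ∈ Icc 0 L := ⟨hx.1.le, hx.2⟩
  obtain ⟨hqi, hq2⟩ := intervalIntegrable_of_memLp hL hq
  obtain ⟨C, hC, hbd⟩ := exists_bound_sine hL hq hS hS0 hS1
  have hsq := summable_sq_sin_coeff hx.1
    (hq.mono_measure (Measure.restrict_mono_set _ (Icc_subset_Icc_right hx.2)))
  set γ : ℕ → ℂ := fun m => ∫ s in 0..x, q s * Complex.sin (m * Real.pi / x * s) with hγ
  set Q := ∫ s in 0..L, ‖q s‖
  have hinj : Function.Injective fun n : ℕ => 2 * n + 1 := fun a b h => by simpa using h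
  refine summable_of_le_div_add (x := x) (K := 2 * Q ^ 2 * C)
    (g := fun n => ‖γ (2 * n + 1)‖) (r := fun n : ℕ => Real.pi / x * (n + 1 / 2)) hx.1
    (by positivity) (hsq.comp_injective hinj) (fun n _ => ?_) fun n _ => ?_
  · have : (n : ℝ) ≤ Real.pi * (n + 1 / 2) := by nlinarith [Real.pi_gt_three]
    rw [div_mul_eq_mul_div]
    exact div_le_div_of_nonneg_right this hx.1.le
  · set r : ℝ := Real.pi / x * (n + 1 / 2) with hr
    have hr0 : 0 < r := by have := hx.1; positivity
    have hrne : (r : ℂ) ≠ 0 := by exact_mod_cast hr0.ne'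
    have hB : ∀ t ∈ Icc 0 L, ‖S r t‖ ≤ C * r⁻¹ := fun t ht => by
      have := hbd r r⁻¹ (fun t ht => by
        have := norm_sinKernel_le_inv hrne ht.1
        rwa [Complex.norm_real, Real.norm_of_nonneg hr0.le] at this) t ht
      simpa using this
    have hmain := (hS r).norm_mul_sub_integral_le hqi hr0 (by positivity) hB hxI
    simp only [hS0, hS1, mul_zero, zero_add, mul_one] at hmain
    -- The leading integral is an odd-indexed sine coefficient of `q`; the additional `1/r` comes
    -- from the free solution `sin(rs)/r`.
    have hI : ∫ s in 0..x, q s * (Complex.sin (r * ((x - s : ℝ) : ℂ)) * sinKernel r s) =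
        (-1) ^ n / (2 * r) * γ (2 * n + 1) := by
      simp only [hγ]
      rw [← intervalIntegral.integral_const_mul]
      refine intervalIntegral.integral_congr fun s _ => ?_
      have := sin_odd_half_mul_sub hx.1 n s
      rw [← hr] at this
      simp only [sinKernel_of_ne hrne]
      rw [mul_div_assoc', this]
      field_simp
    rw [hI] at hmain
    have hnI : ‖(-1 : ℂ) ^ n / (2 * r) * γ (2 * n + 1)‖ = ‖γ (2 * n + 1)‖ / (2 * r) := by
      rw [norm_mul, norm_div, norm_pow, norm_neg, norm_one, one_pow, norm_mul, Complex.norm_two,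
        Complex.norm_real, Real.norm_of_nonneg hr0.le]
      ring
    have h1 : ‖sCoeff S x n‖ = 2 * ‖r * (S r x - sinKernel r x)‖ := by
      rw [sCoeff_eq S hx.1, ← hr, mul_assoc, norm_mul, norm_mul, norm_pow, norm_neg, norm_one,
        one_pow, mul_one, Complex.norm_two]
    have h2 := norm_le_norm_add_norm_sub' (r * (S r x - sinKernel r x))
      ((-1 : ℂ) ^ n / (2 * r) * γ (2 * n + 1))
    rw [h1]
    calc 2 * ‖r * (S r x - sinKernel r x)‖
        ≤ 2 * (‖γ (2 * n + 1)‖ / (2 * r) + Q ^ 2 * (C * r⁻¹) / r) := by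
          rw [hnI] at h2; linarith
      _ = _ := by field_simp

/-- The cardinal series of the sine-type solution, in terms of half-integer sinc pairs. -/
theorem sine_expansion (hq : MemLp q 2 (volume.restrict (Icc 0 L)))
    (hS : ∀ ρ, IsSol (fun t => q t - ρ ^ 2) L (S ρ) (S' ρ)) (hS0 : ∀ ρ, S ρ 0 = 0)
    (hS1 : ∀ ρ, S' ρ 0 = 1) (hSd : Differentiable ℂ fun ρ => S ρ x) (hx : x ∈ Ioc 0 L) :
    (Summable fun n : ℕ => ‖x / Real.pi * ((-1) ^ n / (2 * n + 1)) * sCoeff S x n‖) ∧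
    ∀ ρ, S ρ x = sinKernel ρ x + ∑' n : ℕ, x / Real.pi * ((-1) ^ n / (2 * n + 1)) * sCoeff S x n *
      pair (x / Real.pi) (n + 1 / 2) ρ := by
  have hL : 0 ≤ L := hx.1.le.trans hx.2
  have hxI : x ∈ Icc 0 L := ⟨hx.1.le, hx.2⟩
  obtain ⟨hqi, hq2⟩ := intervalIntegrable_of_memLp hL hq
  obtain ⟨C, hC, hbd⟩ := exists_bound_sine hL hq hS hS0 hS1
  set c : ℕ → ℂ := fun n => x / Real.pi * ((-1) ^ n / (2 * n + 1)) * sCoeff S x n with hc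
  set Q := ∫ s in 0..L, ‖q s‖ with hQ
  have hQ0 : 0 ≤ Q := intervalIntegral.integral_nonneg hL fun _ _ => norm_nonneg _
  have hcs : Summable fun n => ‖c n‖ := by
    refine .of_nonneg_of_le (fun _ => norm_nonneg _) (fun n => ?_)
      ((summable_sCoeff hq hS hS0 hS1 hx).mul_left ‖(x / Real.pi : ℂ)‖)
    rw [hc, norm_mul, norm_mul]
    have h1 : ‖((-1) ^ n / (2 * n + 1) : ℂ)‖ ≤ 1 := by
      have : ‖(2 * n + 1 : ℂ)‖ = 2 * n + 1 := by
        exact_mod_cast Complex.norm_natCast (2 * n + 1)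
      rw [norm_div, norm_pow, norm_neg, norm_one, one_pow, this, div_le_one (by positivity)]
      have : (0 : ℝ) ≤ n := n.cast_nonneg
      linarith
    calc ‖(x / Real.pi : ℂ)‖ * ‖((-1) ^ n / (2 * n + 1) : ℂ)‖ * ‖sCoeff S x n‖
        ≤ ‖(x / Real.pi : ℂ)‖ * 1 * ‖sCoeff S x n‖ := by gcongr
      _ = _ := by rw [mul_one]
  refine ⟨hcs, fun ρ => ?_⟩
  have hFb : ∀ ρ k B, 0 ≤ k → 0 ≤ B →
      (∀ t ∈ Icc 0 L, ‖sinKernel ρ t‖ ≤ k * Real.exp (|ρ.im| * t)) →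
      (∀ t ∈ Icc 0 L, ‖S ρ t‖ ≤ B * Real.exp (|ρ.im| * t)) →
      ‖S ρ x - sinKernel ρ x‖ ≤ Q * (k * B) * Real.exp (|ρ.im| * x) := fun ρ k B hk hB h1 h2 => by
    have := (hS ρ).norm_sub_le hqi hB hk h2 h1 hxI
    rw [hS0, hS1, mul_zero, zero_add, mul_one] at this
    exact this.trans_eq (by ring)
  have hSL : ∀ ρ, ∀ t ∈ Icc 0 L, ‖S ρ t‖ ≤ C * L * Real.exp (|ρ.im| * t) := fun ρ =>
    hbd ρ L fun t ht => norm_sinKernel_le_of_mem ρ ht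
  have hnode : ∀ k : ℕ, S ((Real.pi / x * (k + 1 / 2) : ℝ) : ℂ) x -
      sinKernel ((Real.pi / x * (k + 1 / 2) : ℝ) : ℂ) x = c k := fun k => by
    have hpow : ((-1 : ℂ) ^ k) * (-1) ^ k = 1 := by rw [← mul_pow]; simp
    have hx' : (x : ℂ) ≠ 0 := by exact_mod_cast hx.1.ne'
    have hp : (Real.pi : ℂ) ≠ 0 := by simp
    have hm : (2 * k + 1 : ℂ) ≠ 0 := by exact_mod_cast Nat.succ_ne_zero (2 * k)
    have hco : (x / Real.pi * ((-1) ^ k / (2 * k + 1)) *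
        (2 * (-1) ^ k * ((Real.pi / x * (k + 1 / 2) : ℝ) : ℂ)) : ℂ) = (-1) ^ k * (-1) ^ k := by
      push_cast; field_simp
    simp only [hc]
    rw [sCoeff_eq S hx.1, ← mul_assoc, hco, hpow, one_mul]
  -- Evenness covers the negative nodes, since `-(m+1) + 1/2 = -(m + 1/2)`.
  have heven : ∀ ρ, S (-ρ) x - sinKernel (-ρ) x = S ρ x - sinKernel ρ x := fun ρ => by
    have h1 : S (-ρ) x = S ρ x := (hS (-ρ)).eq_of_sq_eq hL hq (neg_sq ρ).symm (hS ρ)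
      ((hS0 _).trans (hS0 _).symm) ((hS1 _).trans (hS1 _).symm) hxI
    have h2 : sinKernel (-ρ) x = sinKernel ρ x := by
      rw [sinKernel, neg_mul, neg_div, normSinc_neg, sinKernel]
    rw [h1, h2]
  have key := eq_tsum_pair hx.1 (μ := fun n => n + 1 / 2) hcs
    (F := fun ρ => S ρ x - sinKernel ρ x) (hSd.sub (differentiable_sinKernel x))
    (K := Q * (L * (C * L)))
    (fun ρ => hFb ρ L (C * L) hL (by positivity) (fun t ht => norm_sinKernel_le_of_mem ρ ht) (hSL ρ))
    ?_ (1 / 2) (fun k => ?_) ρ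
  · rw [← key, add_sub_cancel]
  · have h0 : Tendsto (fun r : ℝ => Q * (r⁻¹ * (C * L))) atTop (𝓝 0) := by
      simpa using (tendsto_inv_atTop_zero.mul_const (C * L)).const_mul Q
    refine squeeze_zero_norm' ?_ h0
    filter_upwards [eventually_gt_atTop 0] with r hr
    have hrne : (r : ℂ) ≠ 0 := by exact_mod_cast hr.ne'
    have := hFb r r⁻¹ (C * L) (by positivity) (by positivity) (fun t ht => by
        have := norm_sinKernel_le_inv hrne ht.1
        rwa [Complex.norm_real, Real.norm_of_nonneg hr.le] at this) (hSL r)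
    simpa using this
  · rcases Int.eq_nat_or_neg k with ⟨m, rfl | rfl⟩
    · simp only [Int.cast_natCast]
      rw [tsum_pair_half_node hx.1, hnode]
    · rcases m with _ | m
      · have := hnode 0
        have h2 := tsum_pair_half_node hx.1 c 0
        simp only [Nat.cast_zero, neg_zero, Int.cast_zero] at this h2 ⊢
        rw [h2, this]
      · have e : ((Real.pi / x * (((-((m + 1 : ℕ) : ℤ) : ℤ) : ℝ) + 1 / 2) : ℝ) : ℂ) =
            -((Real.pi / x * (m + 1 / 2) : ℝ) : ℂ) := by
          push_cast; ring
        rw [e, heven, hnode]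
        simp only [pair_neg]
        rw [tsum_pair_half_node hx.1]

end Sine

/-! ### Expansion of `φ` -/

section Cosine

variable {φ φ' : ℂ → ℝ → ℂ} {h : ℂ} {x : ℝ}

lemma exists_bound_cosine (hL : 0 ≤ L) (hq : MemLp q 2 (volume.restrict (Icc 0 L)))
    (hφ : ∀ ρ, IsSol (fun t => q t - ρ ^ 2) L (φ ρ) (φ' ρ)) (hφ0 : ∀ ρ, φ ρ 0 = 1)
    (hφ1 : ∀ ρ, φ' ρ 0 = h) :
    ∃ B ≥ 0, ∀ ρ, ∀ t ∈ Icc 0 L, ‖φ ρ t‖ ≤ B * Real.exp (|ρ.im| * t) := by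
  obtain ⟨hqi, hq2⟩ := intervalIntegrable_of_memLp hL hq
  obtain ⟨C, hC, hg⟩ := exists_growth hL hq2 hqi.norm
  refine ⟨C * (1 + L * ‖h‖), by positivity, fun ρ => hg ρ _ _ _ (hφ ρ) fun t ht => ?_⟩
  have h1 := norm_cos_mul_le ρ t
  rw [abs_of_nonneg ht.1] at h1
  have h2 := mul_le_mul_of_nonneg_right (norm_sinKernel_le_of_mem ρ ht) (norm_nonneg h)
  rw [hφ0, hφ1, mul_one]
  refine (norm_add_le _ _).trans ?_
  rw [norm_mul]
  linarith

lemma cos_int_node {x : ℝ} (hx : 0 < x) (n : ℕ) :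
    Complex.cos (((Real.pi / x * n : ℝ) : ℂ) * x) = (-1) ^ n ∧
    Complex.sin (((Real.pi / x * n : ℝ) : ℂ) * x) = 0 := by
  have hx' : (x : ℂ) ≠ 0 := by exact_mod_cast hx.ne'
  have e : ((Real.pi / x * n : ℝ) : ℂ) * x = n * Real.pi := by push_cast; field_simp
  rw [e]
  exact ⟨by exact_mod_cast congrArg Complex.ofReal (Real.cos_nat_mul_pi n),
    Complex.sin_nat_mul_pi n⟩

lemma phiCoeff_eq (φ : ℂ → ℝ → ℂ) {x : ℝ} {n : ℕ} (hn : n ≠ 0) :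
    phiCoeff φ x n = φ ((Real.pi / x * n : ℝ) : ℂ) x - (-1) ^ n := by
  rw [phiCoeff, if_neg hn]
  congr 2
  push_cast
  ring

lemma summable_phiCoeff (hq : MemLp q 2 (volume.restrict (Icc 0 L)))
    (hφ : ∀ ρ, IsSol (fun t => q t - ρ ^ 2) L (φ ρ) (φ' ρ)) (hφ0 : ∀ ρ, φ ρ 0 = 1)
    (hφ1 : ∀ ρ, φ' ρ 0 = h) (hx : x ∈ Ioc 0 L) : Summable fun n => ‖phiCoeff φ x n‖ := by
  have hL : 0 ≤ L := hx.1.le.trans hx.2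
  have hxI : x ∈ Icc 0 L := ⟨hx.1.le, hx.2⟩
  obtain ⟨hqi, hq2⟩ := intervalIntegrable_of_memLp hL hq
  obtain ⟨B, hB, hbd⟩ := exists_bound_cosine hL hq hφ hφ0 hφ1
  have hsq := summable_sq_sin_coeff hx.1
    (hq.mono_measure (Measure.restrict_mono_set _ (Icc_subset_Icc_right hx.2)))
  set γ : ℕ → ℂ := fun m => ∫ s in 0..x, q s * Complex.sin (m * Real.pi / x * s) with hγ
  set Q := ∫ s in 0..L, ‖q s‖
  have hQ0 : 0 ≤ Q := intervalIntegral.integral_nonneg hL fun _ _ => norm_nonneg _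
  have hinj : Function.Injective fun n : ℕ => 2 * n := fun a b h => by simpa using h
  refine summable_of_le_div_add (x := x) (K := Q * ‖h‖ + Q ^ 2 * B)
    (g := fun n => ‖γ (2 * n)‖) (r := fun n : ℕ => Real.pi / x * n) hx.1
    (by positivity) (hsq.comp_injective hinj) (fun n _ => ?_) fun n hn => ?_
  · have : (n : ℝ) ≤ Real.pi * n := by
      have : (0 : ℝ) ≤ n := n.cast_nonneg
      nlinarith [Real.pi_gt_three]
    rw [div_mul_eq_mul_div]
    exact div_le_div_of_nonneg_right this hx.1.le
  · have hn0 : (0 : ℝ) < n := by exact_mod_cast hn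
    obtain ⟨hcos, hsin⟩ := cos_int_node hx.1 n
    have hid := fun s => sin_int_mul_sub hx.1 n s
    have hph := phiCoeff_eq φ (x := x) (n := n) (by omega)
    set r : ℝ := Real.pi / x * n with hr
    have hr0 : 0 < r := by have := hx.1; positivity
    have hrne : (r : ℂ) ≠ 0 := by exact_mod_cast hr0.ne'
    have hsk : sinKernel r x = 0 := by rw [sinKernel_of_ne hrne, hsin, zero_div]
    have hmain := (hφ r).norm_mul_sub_integral_le hqi hr0 hB
      (fun t ht => by simpa using hbd r t ht) hxI
    rw [hφ0, hφ1, hcos, hsk, zero_mul, add_zero, mul_one, ← hph] at hmain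
    set I₁ := ∫ s in 0..x, q s * (Complex.sin (r * ((x - s : ℝ) : ℂ)) * Complex.cos (r * s))
    set I₂ := ∫ s in 0..x, q s * (Complex.sin (r * ((x - s : ℝ) : ℂ)) * (sinKernel r s * h))
    have hqx := intervalIntegrable_of_mem_Icc hqi hxI
    have hskc := continuous_sinKernel r
    have hsplit : ∫ s in 0..x, q s * (Complex.sin (r * ((x - s : ℝ) : ℂ)) *
        (Complex.cos (r * s) * 1 + sinKernel r s * h)) = I₁ + I₂ := by
      rw [← intervalIntegral.integral_add
        (hqx.mul_continuousOn (Continuous.continuousOn (by fun_prop)))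
        (hqx.mul_continuousOn (Continuous.continuousOn (by fun_prop)))]
      refine intervalIntegral.integral_congr fun s _ => ?_
      ring
    have hI1 : ‖I₁‖ ≤ ‖γ (2 * n)‖ := by
      have : I₁ = -((-1) ^ n / 2) * γ (2 * n) := by
        simp only [hγ]
        rw [← intervalIntegral.integral_const_mul]
        refine intervalIntegral.integral_congr fun s _ => ?_
        simp only [hid s]
        ring
      rw [this, norm_mul, norm_neg, norm_div, norm_pow, norm_neg, norm_one, one_pow,
        Complex.norm_two]
      linarith [norm_nonneg (γ (2 * n))]
    -- The part of the free solution coming from `h` carries a factor `1/r`, so only its size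
    -- matters.
    have hI2 : ‖I₂‖ ≤ Q * (r⁻¹ * ‖h‖) := by
      refine norm_integral_mul_le hqi hxI (by positivity) fun s hs => ?_
      have h1 := norm_sinKernel_le_inv hrne hs.1
      rw [Complex.norm_real, Real.norm_of_nonneg hr0.le, Complex.ofReal_im, abs_zero, zero_mul,
        Real.exp_zero, mul_one] at h1
      rw [norm_mul, norm_mul, ← Complex.ofReal_mul]
      calc _ ≤ 1 * (r⁻¹ * ‖h‖) := by
            gcongr
            exact norm_sin_ofReal_le _
        _ = _ := one_mul _
    rw [hsplit] at hmain
    have h1 := norm_le_norm_add_norm_sub' (r * phiCoeff φ x n) (I₁ + I₂)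
    have h2 := norm_add_le I₁ I₂
    rw [norm_mul, Complex.norm_real, Real.norm_of_nonneg hr0.le] at h1
    have h3 : r * ‖phiCoeff φ x n‖ ≤ ‖γ (2 * n)‖ + Q * (r⁻¹ * ‖h‖) + Q ^ 2 * B / r := by linarith
    rw [← le_div_iff₀' hr0] at h3
    refine h3.trans_eq ?_
    field_simp
    ring

/-- The cardinal series of the cosine-type solution. -/
theorem cosine_expansion (hq : MemLp q 2 (volume.restrict (Icc 0 L)))
    (hφ : ∀ ρ, IsSol (fun t => q t - ρ ^ 2) L (φ ρ) (φ' ρ)) (hφ0 : ∀ ρ, φ ρ 0 = 1)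
    (hφ1 : ∀ ρ, φ' ρ 0 = h) (hφd : Differentiable ℂ fun ρ => φ ρ x) (hx : x ∈ Ioc 0 L) (ρ : ℂ) :
    φ ρ x = -(ρ * x * sphericalBesselJOne (ρ * x)) +
      ∑' n : ℕ, phiCoeff φ x n * pair (x / Real.pi) n ρ := by
  have hL : 0 ≤ L := hx.1.le.trans hx.2
  have hxI : x ∈ Icc 0 L := ⟨hx.1.le, hx.2⟩
  obtain ⟨hqi, hq2⟩ := intervalIntegrable_of_memLp hL hq
  obtain ⟨B, hB, hbd⟩ := exists_bound_cosine hL hq hφ hφ0 hφ1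
  have hcs := summable_phiCoeff hq hφ hφ0 hφ1 hx
  set Q := ∫ s in 0..L, ‖q s‖ with hQ
  have hQ0 : 0 ≤ Q := intervalIntegral.integral_nonneg hL fun _ _ => norm_nonneg _
  have hns := differentiable_normSinc
  -- The added sinc vanishes at the nonzero nodes and restores `F 0 = φ(0,x)`, since `cos` and sinc
  -- cancel at `0`. It has type `x` and decays on the real axis, so the interpolation theorem still
  -- applies.
  set F : ℂ → ℂ := fun ρ => φ ρ x - (Complex.cos (ρ * x) - normSinc (ρ * x / Real.pi)) with hF
  have hsub : ∀ ρ, F ρ = (φ ρ x - (Complex.cos (ρ * x) * 1 + sinKernel ρ x * h)) +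
      sinKernel ρ x * h + normSinc (ρ * x / Real.pi) := fun ρ => by simp only [hF]; ring
  have hFd : Differentiable ℂ F := by
    refine hφd.sub (Differentiable.sub ?_ (hns.comp (by fun_prop)))
    exact Complex.differentiable_cos.comp (differentiable_id.mul_const _)
  have hrem : ∀ ρ k, 0 ≤ k → (∀ t ∈ Icc 0 L, ‖sinKernel ρ t‖ ≤ k * Real.exp (|ρ.im| * t)) →
      ‖φ ρ x - (Complex.cos (ρ * x) * 1 + sinKernel ρ x * h)‖ + ‖sinKernel ρ x * h‖ ≤
        k * (Q * B + ‖h‖) * Real.exp (|ρ.im| * x) := fun ρ k hk h1 => by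
    have h2 := (hφ ρ).norm_sub_le hqi hB hk (hbd ρ) h1 hxI
    rw [hφ0, hφ1] at h2
    have h3 := mul_le_mul_of_nonneg_right (h1 x hxI) (norm_nonneg h)
    rw [← norm_mul] at h3
    linarith
  have hsinc : ∀ ρ : ℂ, ‖normSinc (ρ * x / Real.pi)‖ ≤ Real.exp (|ρ.im| * x) := fun ρ => by
    have h1 := norm_normSinc_le (ρ * x / Real.pi)
    rwa [Complex.div_ofReal_im, abs_div, abs_im_mul_ofReal, abs_of_pos Real.pi_pos,
      mul_div_cancel₀ _ Real.pi_ne_zero, abs_of_pos hx.1] at h1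
  have hF3 : ∀ ρ, ‖F ρ‖ ≤ ‖φ ρ x - (Complex.cos (ρ * x) * 1 + sinKernel ρ x * h)‖ +
      ‖sinKernel ρ x * h‖ + ‖normSinc (ρ * x / Real.pi)‖ := fun ρ => by
    rw [hsub]; exact norm_add₃_le
  have hnode : ∀ k : ℕ, F ((Real.pi / x * k : ℝ)) =
      ∑' n : ℕ, phiCoeff φ x n * pair (x / Real.pi) n ((Real.pi / x * k : ℝ)) := fun k => by
    have hx' : (x : ℂ) ≠ 0 := by exact_mod_cast hx.1.ne'
    have hp : (Real.pi : ℂ) ≠ 0 := by simp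
    have e : ((Real.pi / x * k : ℝ) : ℂ) * x / Real.pi = ((k : ℤ) : ℂ) := by
      push_cast; field_simp
    rw [tsum_pair_int_node hx.1]
    simp only [hF]
    rw [(cos_int_node hx.1 k).1, e, normSinc_intCast_eq]
    split_ifs with h1 h2 h2
    · have h0 : k = 0 := by exact_mod_cast h1
      subst h0
      simp only [phiCoeff, if_true, Nat.cast_zero, mul_zero, Complex.ofReal_zero, pow_zero]
      ring
    · exact absurd (by exact_mod_cast h1) h2
    · exact absurd (by exact_mod_cast h2) h1
    · rw [phiCoeff_eq φ h2, sub_zero]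
  have heven : ∀ ρ, F (-ρ) = F ρ := fun ρ => by
    have h1 : φ (-ρ) x = φ ρ x := (hφ (-ρ)).eq_of_sq_eq hL hq (neg_sq ρ).symm (hφ ρ)
      ((hφ0 _).trans (hφ0 _).symm) ((hφ1 _).trans (hφ1 _).symm) hxI
    simp only [hF]
    rw [h1, neg_mul, Complex.cos_neg, neg_div, normSinc_neg]
  have key := eq_tsum_pair hx.1 (μ := fun n => n) hcs hFd (K := L * (Q * B + ‖h‖) + 1)
    (fun ρ => ?_) ?_ 0 (fun k => ?_) ρ
  · rw [← key, neg_mul_sphericalBesselJOne]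
    simp only [hF]
    ring
  · have h1 := hrem ρ L hL fun t ht => norm_sinKernel_le_of_mem ρ ht
    have h2 := hsinc ρ
    have h3 := hF3 ρ
    rw [add_mul, one_mul]
    linarith
  · have h0 : Tendsto (fun r : ℝ => r⁻¹ * (Q * B + ‖h‖) +
        ‖normSinc ((x / Real.pi : ℝ) * r + (0 : ℝ))‖) atTop (𝓝 0) := by
      simpa using (tendsto_inv_atTop_zero.mul_const (Q * B + ‖h‖)).add
        (tendsto_normSinc_ofReal (x / Real.pi) 0 (div_pos hx.1 Real.pi_pos)).norm
    refine squeeze_zero_norm' ?_ h0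
    filter_upwards [eventually_gt_atTop 0] with r hr
    have hrne : (r : ℂ) ≠ 0 := by exact_mod_cast hr.ne'
    have h1 := hrem r r⁻¹ (by positivity) fun t ht => by
      have := norm_sinKernel_le_inv hrne ht.1
      rwa [Complex.norm_real, Real.norm_of_nonneg hr.le] at this
    rw [Complex.ofReal_im, abs_zero, zero_mul, Real.exp_zero] at h1
    have e : ((x / Real.pi : ℝ) * r + (0 : ℝ) : ℂ) = r * x / Real.pi := by push_cast; ring
    rw [e]
    exact (hF3 r).trans (by linarith)
  · rw [add_zero]
    rcases Int.eq_nat_or_neg k with ⟨m, rfl | rfl⟩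
    · simp only [Int.cast_natCast]
      exact hnode m
    · have e : ((Real.pi / x * ((-(m : ℤ) : ℤ) : ℝ) : ℝ) : ℂ) = -((Real.pi / x * m : ℝ) : ℂ) := by
        push_cast; ring
      rw [e, heven, hnode]
      simp only [pair_neg]

end Cosine

end SturmLiouville

/-! ### Assembly of the theorem -/

theorem mainTheorem1 (L : ℝ) (hL : 0 < L) (q : ℝ → ℂ)
    (hq : MemLp q 2 (volume.restrict (Set.Icc 0 L))) (h : ℂ)
    (S φ : ℂ → ℝ → ℂ)
    (hS : ∀ ρ : ℂ, SolvesSturmLiouville q L ρ 0 1 (S ρ))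
    (hφ : ∀ ρ : ℂ, SolvesSturmLiouville q L ρ 1 h (φ ρ))
    (x : ℝ) (hx : x ∈ Set.Ioc 0 L) :
    -- the series representation of `S`; the zeros of `ρ sin(ρx)` are removable singularities
    (∀ ρ : ℂ, Summable fun n => sCoeff S x n * oddSincPair x n ρ) ∧
    (∀ ρ : ℂ, Complex.sin (ρ * x) ≠ 0 →
      S ρ x = Complex.sin (ρ * x) / ρ +
        1 / (2 * ρ * Complex.sin (ρ * x)) * ∑' n, sCoeff S x n * oddSincPair x n ρ) ∧
    (∀ ρ : ℂ, Tendsto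
      (fun z : ℂ => Complex.sin (z * x) / z +
        1 / (2 * z * Complex.sin (z * x)) * ∑' n, sCoeff S x n * oddSincPair x n z)
      (𝓝[≠] ρ) (𝓝 (S ρ x))) ∧
    -- convergence of the cardinal series of `S`, without and with the factor `1/(2ρ sin(ρx))`
    SeriesConverges Set.univ (fun n ρ => sCoeff S x n * oddSincPair x n ρ)
      (fun ρ => ∑' n, sCoeff S x n * oddSincPair x n ρ) ∧
    SeriesConverges {ρ : ℂ | Complex.sin (ρ * x) ≠ 0}
      (fun n ρ => 1 / (2 * ρ * Complex.sin (ρ * x)) * (sCoeff S x n * oddSincPair x n ρ))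
      (fun ρ => S ρ x - Complex.sin (ρ * x) / ρ) ∧
    -- the series representation of `φ` and its convergence
    (∀ ρ : ℂ, Summable fun n => phiCoeff φ x n * sincPair x n ρ) ∧
    (∀ ρ : ℂ, φ ρ x = -(ρ * x * sphericalBesselJOne (ρ * x)) +
      ∑' n, phiCoeff φ x n * sincPair x n ρ) ∧
    SeriesConverges Set.univ (fun n ρ => phiCoeff φ x n * sincPair x n ρ)
      (fun ρ => φ ρ x + ρ * x * sphericalBesselJOne (ρ * x)) := by
  have hxI : x ∈ Set.Icc 0 L := ⟨hx.1.le, hx.2⟩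
  have hx0 : x ≠ 0 := hx.1.ne'
  have hπ := Real.pi_ne_zero
  choose S' hS0 hS1 hS2 using fun ρ => (hS ρ).exists_isSol
  choose φ' hφ0 hφ1 hφ2 using fun ρ => (hφ ρ).exists_isSol
  obtain ⟨hqi, hq2⟩ := SturmLiouville.intervalIntegrable_of_memLp hL.le hq
  have hSd : Differentiable ℂ fun ρ => S ρ x :=
    -- The families `S` and `φ` themselves serve as the fundamental system.
    SturmLiouville.differentiable_solution hL.le hq2 hqi.norm hS2 hS0 hS1 hS2 hS0 hS1 hφ2 hφ0 hφ1 hxI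
  have hφd : Differentiable ℂ fun ρ => φ ρ x :=
    SturmLiouville.differentiable_solution hL.le hq2 hqi.norm hφ2 hφ0 hφ1 hS2 hS0 hS1 hφ2 hφ0 hφ1 hxI
  have hs := SturmLiouville.summable_sCoeff hq hS2 hS0 hS1 hx
  have hp := SturmLiouville.summable_phiCoeff hq hφ2 hφ0 hφ1 hx
  obtain ⟨hc, hSrep⟩ := SturmLiouville.sine_expansion hq hS2 hS0 hS1 hSd hx
  have hφrep := SturmLiouville.cosine_expansion hq hφ2 hφ0 hφ1 hφd hx
  have hterm : ∀ ρ : ℂ, Complex.sin (ρ * x) ≠ 0 → ∀ n,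
      1 / (2 * ρ * Complex.sin (ρ * x)) * (sCoeff S x n * oddSincPair x n ρ) =
        x / Real.pi * ((-1) ^ n / (2 * n + 1)) * sCoeff S x n *
          SturmLiouville.pair (x / Real.pi) (n + 1 / 2) ρ := fun ρ hρ n => by
    have hρ0 : ρ ≠ 0 := fun h => hρ (by simp [h])
    rw [SturmLiouville.oddSincPair_eq]
    field_simp
  have hSρ : ∀ ρ : ℂ, Complex.sin (ρ * x) ≠ 0 → S ρ x = Complex.sin (ρ * x) / ρ +
      1 / (2 * ρ * Complex.sin (ρ * x)) * ∑' n, sCoeff S x n * oddSincPair x n ρ :=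
    fun ρ hρ => by
      have hρ0 : ρ ≠ 0 := fun h => hρ (by simp [h])
      rw [hSrep, SturmLiouville.sinKernel_of_ne hρ0, ← tsum_mul_left]
      simp only [hterm ρ hρ]
  refine ⟨fun ρ => ?_, hSρ, fun ρ => ?_, ?_, ?_, fun ρ => ?_, fun ρ => ?_, ?_⟩
  · simp only [SturmLiouville.oddSincPair_eq_pair]
    exact (SturmLiouville.summable_norm_term hs ρ).of_norm
  -- The formula holds on a punctured neighbourhood, zeros of the sine being isolated, and `S(·,x)`
  -- is continuous.
  · refine Tendsto.congr' ?_ ((hSd.continuous.tendsto ρ).mono_left nhdsWithin_le_nhds)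
    filter_upwards [SturmLiouville.eventually_sin_ne_zero hx.1 ρ] with z hz using hSρ z hz
  -- Without the prefactor the terms are already sinc pairs, of type `2x`, with summable
  -- coefficients `s_n`.
  · exact SturmLiouville.seriesConverges_of_pair (a := 2 * x / Real.pi) (μ := fun n => 2 * n + 1)
      (by positivity) hs (fun n ρ _ => by rw [SturmLiouville.oddSincPair_eq_pair])
      (fun ρ _ => by simp only [SturmLiouville.oddSincPair_eq_pair]) (by simp)
  · refine SturmLiouville.seriesConverges_of_pair (a := x / Real.pi) (μ := fun n => n + 1 / 2)
      (by positivity) hc (fun n ρ hρ => hterm ρ hρ n) (fun ρ hρ => ?_)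
      (SturmLiouville.ae_sin_ne_zero hx.1)
    have hρ0 : ρ ≠ 0 := fun h => hρ (by simp [h])
    rw [hSrep, SturmLiouville.sinKernel_of_ne hρ0, add_sub_cancel_left]
  · simp only [SturmLiouville.sincPair_eq]
    exact (SturmLiouville.summable_norm_term hp ρ).of_norm
  · simp only [SturmLiouville.sincPair_eq]
    exact hφrep ρ
  · refine SturmLiouville.seriesConverges_of_pair (a := x / Real.pi) (μ := fun n => n)
      (by positivity) hp (fun n ρ _ => by rw [SturmLiouville.sincPair_eq]) (fun ρ _ => ?_) (by simp)
    rw [hφrep]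
    ring
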